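/- All systems are finite-dimensional of nonzero dimension; $\mathcal B_A$ denotes the operators on the Hilbert space of system $A$. A state is a positive semidefinite operator of unit trace, a channel is a completely positive trace-preserving linear map, and a subchannel is a completely positive trace-nonincreasing linear map. **Projective mutual information.** For states $\rho,\sigma$ let $D_{\max}(\rho\|\sigma)=\log_2\inf\{\lambda\in\mathbb R:\rho\le\lambda\sigma\}$ (equal to $+\infty$ if there is no such $\lambda$) and $D_\Omega(\rho\|\sigma)=D_{\max}(\rho\|\sigma)+D_{\max}(\sigma\|\rho)$. For a channel $\mathcal N_{A\to B}$ let $$I_\Omega(\mathcal N)=\sup_{\rho_{RA}}\ \inf_{\sigma_B}\ D_\Omega\big((\mathrm{id}_R\otimes\mathcal N)[\rho_{RA}]\,\big\|\,\rho_R\otimes\sigma_B\big)\in[0,\infty],$$ where the supremum is over all systems $R$ and all states $\rho_{RA}$, and the infimum is over all states $\sigma_B$. **Supermaps and protocols.** A superchannel (respectively, a probabilistic supermap) $\Theta_{(A\to B)\to(M\to\hat M)}$ is a linear map from linear maps $\mathcal B_A\to\mathcal B_B$ to linear maps $\mathcal B_M\to\mathcal B_{\hat M}$ which, also when tensored with the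 identity supermap on maps between arbitrary auxiliary systems, sends channels to channels (respectively, to subchannels). It corresponds to a bipartite map $\bar\Theta_{MB\to A\hat M}$ determined by $\langle a|_A\,\bar\Theta[\rho_M\otimes\sigma_B]\,|a'\rangle_A=\Theta\{X\mapsto\langle a|X|a'\rangle\,\sigma\}[\rho]$. Here $d_{\hat M}=d_M$. * $\Theta$ is a pEA protocol if it is a probabilistic supermap and there are a state $\gamma_{A'B'}$, a channel $\mathcal E_{MA'\to A}$ and a subchannel $\mathcal D_{BB'\to\hat M}$ with $\Theta\{\mathcal N\}[\rho_M]=(\mathcal D\circ\mathcal N\circ\mathcal E)[\rho_M\otimes\gamma_{A'B'}]$ for all $\mathcal N$ and $\rho_M$. * An NA protocol is a superchannel $\Xi$ with $\mathrm{Tr}_A\bar\Xi[\rho_M\otimes\sigma_B]=\mathrm{Tr}_A\bar\Xi[\omega_M\otimes\sigma_B]$ for all states $\rho_M,\omega_M,\sigma_B$. $\Theta$ is a pNA protocol if it is a probabilistic supermap and there are an NA protocol $\Xi_{(A\to B)\to(M\to\hat MX)}$, with $X$ a two-dimensional flag system, and a subchannel $\mathcal D_{\hat MX\to\hat M}$ with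 $\Theta\{\mathcal N\}=\mathcal D\circ\Xi\{\mathcal N\}$ for all $\mathcal N$. **Errors and capacities.** With $\mathcal N'=\Theta\{\mathcal N\}$, the worst-case conditional error probabilities are $$P^{(c)}_{\mathrm{err}}(\Theta;\mathcal N)=1-\min_{1\le m\le d_M}\frac{\langle m|\,\mathcal N'[|m\rangle\langle m|]\,|m\rangle}{\mathrm{Tr}\,\mathcal N'[|m\rangle\langle m|]},\qquad P^{(q)}_{\mathrm{err}}(\Theta;\mathcal N)=1-\inf_{\psi_{RM}}\frac{\mathrm{Tr}\big[\psi_{R\hat M}\,\mathcal N'[\psi_{RM}]\big]}{\mathrm{Tr}\,\mathcal N'[\psi_{RM}]},$$ where the infimum is over all systems $R$ and all pure states $\psi_{RM}$, and a ratio with vanishing denominator (an input that is never decoded conclusively) counts as $0$. For $\mathsf T\in\{\mathrm{pEA},\mathrm{pNA}\}$ and $\varepsilon\in(0,1)$ let $C^\varepsilon_{\mathsf T}(\mathcal N)$ (respectively, $Q^\varepsilon_{\mathsf T}(\mathcal N)$) be the supremum of $\log_2 d_M$ over all $\Theta\in\mathsf T$ with $P^{(c)}_{\mathrm{err}}(\Theta;\mathcal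 N)\le\varepsilon$ (respectively, $P^{(q)}_{\mathrm{err}}(\Theta;\mathcal N)\le\varepsilon$), and let $$C_{\mathsf T}(\mathcal N)=\inf_{\varepsilon\in(0,1)}\liminf_{n\to\infty}\tfrac1n C^\varepsilon_{\mathsf T}(\mathcal N^{\otimes n}),\qquad \tilde C_{\mathsf T}(\mathcal N)=\sup_{\varepsilon\in(0,1)}\limsup_{n\to\infty}\tfrac1n C^\varepsilon_{\mathsf T}(\mathcal N^{\otimes n}),$$ and define $Q_{\mathsf T}(\mathcal N)$ and $\tilde Q_{\mathsf T}(\mathcal N)$ in the same way from $Q^\varepsilon_{\mathsf T}$. All these quantities take values in $[0,\infty]$. **Theorem (asymptotic pEA and pNA capacities).** For every quantum channel $\mathcal N_{A\to B}$, $$I_\Omega(\mathcal N)=C_{\mathrm{pEA}}(\mathcal N)=C_{\mathrm{pNA}}(\mathcal N)=2Q_{\mathrm{pEA}}(\mathcal N)=2Q_{\mathrm{pNA}}(\mathcal N)=\tilde C_{\mathrm{pEA}}(\mathcal N)=\tilde C_{\mathrm{pNA}}(\mathcal N)=2\tilde Q_{\mathrm{pEA}}(\mathcal N)=2\tilde Q_{\mathrm{pNA}}(\mathcal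 N).$$ -/

import Mathlib

open scoped Kronecker ComplexOrder

noncomputable section

namespace Postselected

universe u v

/-! A finite-dimensional quantum system with Hilbert space `ℂ^A` is represented by its finite index
type `A`; a composite system is the product type.  Auxiliary systems are `Fin r` with `r : ℕ`
arbitrary. -/

/-- Operators on the Hilbert space `ℂ^A`, as matrices in the computational basis. -/
abbrev Op (A : Type*) := Matrix A A ℂ

/-- Linear maps from operators on system `A` to operators on system `B`. -/
abbrev LMap (A B : Type*) := Op A →ₗ[ℂ] Op B

/-! ### States, channels and subchannels -/

/-- Quantum states: positive semidefinite of unit trace. -/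
def IsState {A : Type*} [Fintype A] (ρ : Op A) : Prop :=
  ρ.PosSemidef ∧ ρ.trace = 1

/-- `id_R ⊗ N`, acting blockwise. -/
def idTensor (R : Type*) {A B : Type*} (N : LMap A B) : LMap (R × A) (R × B) where
  toFun X := Matrix.of fun p q => N (Matrix.of fun a a' => X (p.1, a) (q.1, a')) p.2 q.2
  map_add' X Y := by
    ext p q
    exact congrFun (congrFun (N.map_add (Matrix.of fun a a' => X (p.1, a) (q.1, a'))
      (Matrix.of fun a a' => Y (p.1, a) (q.1, a'))) p.2) q.2
  map_smul' c X := by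
    ext p q
    exact congrFun (congrFun (N.map_smul c (Matrix.of fun a a' => X (p.1, a) (q.1, a'))) p.2) q.2

/-- `N ⊗ id_R`, acting blockwise. -/
def tensorId (R : Type*) {A B : Type*} (N : LMap A B) : LMap (A × R) (B × R) where
  toFun X := Matrix.of fun p q => N (Matrix.of fun a a' => X (a, p.2) (a', q.2)) p.1 q.1
  map_add' X Y := by
    ext p q
    exact congrFun (congrFun (N.map_add (Matrix.of fun a a' => X (a, p.2) (a', q.2))
      (Matrix.of fun a a' => Y (a, p.2) (a', q.2))) p.1) q.1
  map_smul' c X := by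
    ext p q
    exact congrFun (congrFun (N.map_smul c (Matrix.of fun a a' => X (a, p.2) (a', q.2))) p.1) q.1

/-- Complete positivity: `id_R ⊗ N` is positive for every finite-dimensional `R`. -/
def IsCP {A B : Type*} (N : LMap A B) : Prop :=
  ∀ (r : ℕ) (X : Op (Fin r × A)), X.PosSemidef → (idTensor (Fin r) N X).PosSemidef

/-- Quantum channels: completely positive and trace preserving. -/
def IsChannel {A B : Type*} [Fintype A] [Fintype B] (N : LMap A B) : Prop :=
  IsCP N ∧ ∀ X : Op A, (N X).trace = X.trace

/-- Subchannels: completely positive and trace nonincreasing. -/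
def IsSubchannel {A B : Type*} [Fintype A] [Fintype B] (N : LMap A B) : Prop :=
  IsCP N ∧ ∀ X : Op A, X.PosSemidef → (N X).trace.re ≤ X.trace.re

/-- The `n`-fold tensor power `N^{⊗n}`, on the systems `A^n = (Fin n → A)` and `B^n`: the matrix
unit `|a⟩⟨a'|` is sent to `⨂ i, N(|a i⟩⟨a' i|)`. -/
def tensorPow {A B : Type*} [Fintype A] [DecidableEq A] (n : ℕ) (N : LMap A B) :
    LMap (Fin n → A) (Fin n → B) where
  toFun X := Matrix.of fun b b' => ∑ a : Fin n → A, ∑ a' : Fin n → A,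
    X a a' * ∏ i, N (Matrix.single (a i) (a' i) 1) (b i) (b' i)
  map_add' X Y := by
    ext b b'
    simp [add_mul, Finset.sum_add_distrib]
  map_smul' c X := by
    ext b b'
    simp [Finset.mul_sum, mul_assoc]

/-- Partial trace over the first tensor factor. -/
def traceFst {A B : Type*} [Fintype A] (X : Op (A × B)) : Op B :=
  Matrix.of fun b b' => ∑ a, X (a, b) (a, b')

/-- Partial trace over the second tensor factor. -/
def traceSnd {A B : Type*} [Fintype B] (X : Op (A × B)) : Op A :=
  Matrix.of fun a a' => ∑ b, X (a, b) (a', b)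

/-! ### Projective mutual information -/

/-- Max-relative entropy `log₂ inf {l : ρ ≤ l σ}` of two states, with value `⊤` if no such `l`
exists.  (For states every admissible `l` is at least `1`, so `0 < l` excludes nothing.) -/
def Dmax {A : Type*} (ρ σ : Op A) : EReal :=
  ⨅ (l : ℝ) (_ : 0 < l) (_ : (l • σ - ρ).PosSemidef), ((Real.logb 2 l : ℝ) : EReal)

/-- Hilbert projective metric of two states. -/
def DOmega {A : Type*} (ρ σ : Op A) : EReal := Dmax ρ σ + Dmax σ ρ

/-- Projective mutual information `I_Ω(R;B)_ρ` of a bipartite state on `R × B`. -/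
def stateIOmega {R B : Type*} [Fintype B] (ρ : Op (R × B)) : EReal :=
  ⨅ (σ : Op B) (_ : IsState σ), DOmega ρ (traceSnd ρ ⊗ₖ σ)

/-- Projective mutual information `I_Ω(N)` of a channel. -/
def IOmega {A B : Type*} [Fintype A] [Fintype B] (N : LMap A B) : EReal :=
  ⨆ (r : ℕ) (ρ : Op (Fin r × A)) (_ : IsState ρ), stateIOmega (idTensor (Fin r) N ρ)

/-! ### Supermaps -/

/-- Linear supermaps `(A → B) → (M → M')`. -/
abbrev Supermap (A B M M' : Type*) := LMap A B →ₗ[ℂ] LMap M M'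

/-- The block of `K : RA → SB` at `r, r' : R` and `s, s' : S`, that is, the linear map
`X ↦ ⟨s| K(|r⟩⟨r'| ⊗ X) |s'⟩`. -/
def block {R S A B : Type*} [DecidableEq R] (K : LMap (R × A) (S × B)) (r r' : R) (s s' : S) :
    LMap A B where
  toFun X := Matrix.of fun b b' => K (Matrix.single r r' (1 : ℂ) ⊗ₖ X) (s, b) (s', b')
  map_add' X Y := by
    ext b b'
    simp [Matrix.kronecker_add]
  map_smul' c X := by
    ext b b'
    simp [Matrix.kronecker_smul]

/-- The supermap `Θ` tensored with the identity supermap on maps `R → S`, applied to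
`K : RA → SB`. -/
def Supermap.extend {A B M M' : Type*} (R S : Type*) [Fintype R] [DecidableEq R]
    (Θ : Supermap A B M M') (K : LMap (R × A) (S × B)) : LMap (R × M) (S × M') where
  toFun Z := Matrix.of fun p q => ∑ r : R, ∑ r' : R,
    Θ (block K r r' p.1 q.1) (Matrix.of fun m m' => Z (r, m) (r', m')) p.2 q.2
  map_add' X Y := by
    ext p q
    simp only [Matrix.of_apply, Matrix.add_apply, ← Finset.sum_add_distrib]
    refine Finset.sum_congr rfl fun r _ => Finset.sum_congr rfl fun r' _ => ?_
    exact congrFun (congrFun ((Θ (block K r r' p.1 q.1)).map_add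
      (Matrix.of fun m m' => X (r, m) (r', m')) (Matrix.of fun m m' => Y (r, m) (r', m'))) p.2) q.2
  map_smul' c X := by
    ext p q
    simp only [Matrix.of_apply, Matrix.smul_apply, RingHom.id_apply, Finset.smul_sum]
    refine Finset.sum_congr rfl fun r _ => Finset.sum_congr rfl fun r' _ => ?_
    exact congrFun (congrFun ((Θ (block K r r' p.1 q.1)).map_smul c
      (Matrix.of fun m m' => X (r, m) (r', m'))) p.2) q.2

/-- Superchannels (deterministic supermaps): channels are sent to channels, also when the supermap
acts on one part of a bipartite channel. -/
def IsSuperchannel {A B M M' : Type*} [Fintype A] [Fintype B] [Fintype M] [Fintype M']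
    (Θ : Supermap A B M M') : Prop :=
  ∀ (r s : ℕ) (K : LMap (Fin r × A) (Fin s × B)), IsChannel K →
    IsChannel (Θ.extend (Fin r) (Fin s) K)

/-- Probabilistic supermaps: channels are sent to subchannels, also when the supermap acts on one
part of a bipartite channel. -/
def IsProbSupermap {A B M M' : Type*} [Fintype A] [Fintype B] [Fintype M] [Fintype M']
    (Θ : Supermap A B M M') : Prop :=
  ∀ (r s : ℕ) (K : LMap (Fin r × A) (Fin s × B)), IsChannel K →
    IsSubchannel (Θ.extend (Fin r) (Fin s) K)

/-- The bipartite map `MB → AM'` equivalent to the supermap `Θ`: its `(a, a')` block on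
`ρ ⊗ σ` is `Θ{X ↦ X a a' • σ}[ρ]`.  If `Θ{N} = D ∘ N ∘ E` with `E : M → AE'` and `D : BE' → M'`,
it is the channel that applies `E` to `M` and then `D` to `BE'`, and outputs `A` and `M'`. -/
def Supermap.bipartite {A B M M' : Type*} [Fintype B] [DecidableEq B] [Fintype M] [DecidableEq M]
    (Θ : Supermap A B M M') : LMap (M × B) (A × M') where
  toFun Z := Matrix.of fun p q => ∑ i : M, ∑ j : M, ∑ b : B, ∑ b' : B,
    Z (i, b) (j, b') *
      Θ ((Matrix.entryLinearMap ℂ ℂ p.1 q.1).smulRight (Matrix.single b b' (1 : ℂ)))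
        (Matrix.single i j 1) p.2 q.2
  map_add' X Y := by
    ext p q
    simp [add_mul, Finset.sum_add_distrib]
  map_smul' c X := by
    ext p q
    simp [Finset.mul_sum, mul_assoc]

/-! ### Postselected entanglement-assisted and nonsignalling-assisted protocols -/

/-- Postselected entanglement-assisted protocols: `Θ{N}[ρ] = (D ∘ N ∘ E)[ρ_M ⊗ γ_{A'B'}]` with a
shared state `γ`, an encoding channel `E : MA' → A` and a decoding subchannel `D : BB' → M'`. -/
def IsPEA {A B M M' : Type*} [Fintype A] [Fintype B] [Fintype M] [Fintype M']
    (Θ : Supermap A B M M') : Prop :=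
  IsProbSupermap Θ ∧
  ∃ (a b : ℕ) (γ : Op (Fin a × Fin b)) (E : LMap (M × Fin a) A) (D : LMap (B × Fin b) M'),
    IsState γ ∧ IsChannel E ∧ IsSubchannel D ∧
    ∀ (N : LMap A B) (ρ : Op M),
      Θ N ρ = D (tensorId (Fin b) N (tensorId (Fin b) E
        ((ρ ⊗ₖ γ).submatrix (Equiv.prodAssoc M (Fin a) (Fin b))
          (Equiv.prodAssoc M (Fin a) (Fin b)))))

/-- Nonsignalling-assisted protocols: superchannels whose bipartite channel is Alice-to-Bob
nonsignalling. -/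
def IsNA {A B M M' : Type*} [Fintype A] [Fintype B] [DecidableEq B] [Fintype M] [DecidableEq M]
    [Fintype M'] (Θ : Supermap A B M M') : Prop :=
  IsSuperchannel Θ ∧
  ∀ (ρ ω : Op M) (σ : Op B), IsState ρ → IsState ω → IsState σ →
    traceFst (Θ.bipartite (ρ ⊗ₖ σ)) = traceFst (Θ.bipartite (ω ⊗ₖ σ))

/-- Postselected nonsignalling-assisted protocols: an NA protocol with output `M'X`, where `X` is
a two-dimensional flag system, followed by a subchannel `M'X → M'`. -/
def IsPNA {A B M M' : Type*} [Fintype A] [Fintype B] [DecidableEq B] [Fintype M] [DecidableEq M]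
    [Fintype M'] (Θ : Supermap A B M M') : Prop :=
  IsProbSupermap Θ ∧
  ∃ (Ξ : Supermap A B M (M' × Fin 2)) (D : LMap (M' × Fin 2) M'),
    IsNA Ξ ∧ IsSubchannel D ∧ ∀ (N : LMap A B) (ρ : Op M), Θ N ρ = D (Ξ N ρ)

/-! ### Conditional error probabilities

The ratios are conditional success probabilities given a conclusive outcome.  They are `0` (error
`1`) for an input on which the outcome is never conclusive, by the convention `x / 0 = 0`. -/

/-- Worst-case conditional error probability of classical communication. -/
def errC {A B : Type*} {d : ℕ} (Θ : Supermap A B (Fin d) (Fin d)) (N : LMap A B) : ℝ :=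
  1 - ⨅ m : Fin d, (Θ N (Matrix.single m m 1) m m).re / (Θ N (Matrix.single m m 1)).trace.re

/-- Worst-case conditional error probability of quantum communication; the infimum is over all
reference systems and all pure states `ψ = |v⟩⟨v|`. -/
def errQ {A B : Type*} {d : ℕ} (Θ : Supermap A B (Fin d) (Fin d)) (N : LMap A B) : ℝ :=
  1 - sInf {x : ℝ | ∃ (r : ℕ) (v : Fin r × Fin d → ℂ), ∑ i, ‖v i‖ ^ 2 = 1 ∧
    x = (Matrix.vecMulVec v (star v) *
          idTensor (Fin r) (Θ N) (Matrix.vecMulVec v (star v))).trace.re /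
        (idTensor (Fin r) (Θ N) (Matrix.vecMulVec v (star v))).trace.re}

/-! ### Capacities -/

/-- A class of supermaps `(A → B) → (M → M')`, for all `A`, `B` and all dimensions `d` of the
message system `M` and of its recovery `M'`. -/
def SupermapClass : Type (max u v + 1) :=
  ∀ (A : Type u) (B : Type v) [Fintype A] [DecidableEq A] [Fintype B] [DecidableEq B] (d : ℕ),
    Set (Supermap A B (Fin d) (Fin d))

/-- The class of pEA protocols. -/
def pEA : SupermapClass.{u, v} := fun _ _ _ _ _ _ _ => {Θ | IsPEA Θ}

/-- The class of pNA protocols. -/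
def pNA : SupermapClass.{u, v} := fun _ _ _ _ _ _ _ => {Θ | IsPNA Θ}

section

variable (T : SupermapClass.{u, v}) {A : Type u} {B : Type v} [Fintype A] [DecidableEq A]
  [Fintype B] [DecidableEq B]

/-- One-shot `ε`-error `T`-assisted classical capacity. -/
def oneShotC (ε : ℝ) (N : LMap A B) : EReal :=
  sSup {x : EReal | ∃ (d : ℕ) (Θ : Supermap A B (Fin d) (Fin d)),
    1 ≤ d ∧ Θ ∈ T A B d ∧ errC Θ N ≤ ε ∧ x = ((Real.logb 2 d : ℝ) : EReal)}

/-- One-shot `ε`-error `T`-assisted quantum capacity. -/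
def oneShotQ (ε : ℝ) (N : LMap A B) : EReal :=
  sSup {x : EReal | ∃ (d : ℕ) (Θ : Supermap A B (Fin d) (Fin d)),
    1 ≤ d ∧ Θ ∈ T A B d ∧ errQ Θ N ≤ ε ∧ x = ((Real.logb 2 d : ℝ) : EReal)}

/-- Asymptotic `T`-assisted classical capacity. -/
def capC (N : LMap A B) : EReal :=
  ⨅ ε : Set.Ioo (0 : ℝ) 1, Filter.liminf
    (fun n : ℕ => ((1 / n : ℝ) : EReal) * oneShotC T ε (tensorPow n N)) Filter.atTop

/-- Asymptotic `T`-assisted quantum capacity. -/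
def capQ (N : LMap A B) : EReal :=
  ⨅ ε : Set.Ioo (0 : ℝ) 1, Filter.liminf
    (fun n : ℕ => ((1 / n : ℝ) : EReal) * oneShotQ T ε (tensorPow n N)) Filter.atTop

/-- Strong converse `T`-assisted classical capacity. -/
def strongC (N : LMap A B) : EReal :=
  ⨆ ε : Set.Ioo (0 : ℝ) 1, Filter.limsup
    (fun n : ℕ => ((1 / n : ℝ) : EReal) * oneShotC T ε (tensorPow n N)) Filter.atTop

/-- Strong converse `T`-assisted quantum capacity. -/
def strongQ (N : LMap A B) : EReal :=
  ⨆ ε : Set.Ioo (0 : ℝ) 1, Filter.limsup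
    (fun n : ℕ => ((1 / n : ℝ) : EReal) * oneShotQ T ε (tensorPow n N)) Filter.atTop

end

end Postselected

end

open Postselected

noncomputable section

namespace Postselected

open Matrix Filter

set_option linter.unusedSectionVars false

/-! ### Closure properties of positive semidefinite matrices. -/

section PosSemidef

variable {ι κ l : Type*}

/-! Everything reduces to comparing `N` with replacer channels `R_σ : X ↦ (Tr X) σ` in the order of
complete positivity: `N ≤ k R_σ` and `R_σ ≤ l N` (`IsComparable`). A comparison bounds the
projective mutual information by `log (k l)`, uniformly in the input state (`IOmega_le`).
Conversely, testing only the maximally entangled input, whose output is the normalized Choi matrix,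
already yields comparisons with `log (k l)` arbitrarily close to `IOmega N`
(`exists_isComparable_of_IOmega_lt`). Comparisons are multiplicative under tensor powers
(`IsComparable.tensorPow`).

Converse. Nonsignalling forces a pNA protocol to send `R_σ` to a replacer `R_τ`, and a probabilistic
supermap preserves the two inequalities (`IsPNA.exists_isComparable`). Hence the effective map is
sandwiched by a map whose output carries no message. Its success weights sum to `Tr τ` over the `d`
messages, or equal `Tr τ / d²` on a maximally entangled input, so `d (1 - ε) ≤ k l`, respectively
`d² (1 - ε) ≤ k l` (`le_of_errC_le`, `le_of_errQ_le`). The error only contributes a constant to the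
logarithm, whence the strong converse.

Achievability. If `k = 2 ^ x` with `x < IOmega N`, no `P` satisfies `J ≤ 1 ⊗ P ≤ k J` for the Choi
matrix `J` (`IOmega_le_of_sandwich`). Hahn–Banach then gives positive `X`, `Y` with a common
full-rank marginal on `B` and `⟨X, J⟩ > k ⟨Y, J⟩` (`exists_dual_witness`). The common marginal means
that both are steered from one pure state, so they become two encoders and a single effect of Bob
whose probabilities under the two encoders have ratio above `k` (`exists_encoders`); tensor powers
raise the ratio to `k ^ n`. Alice tests whether a blind guess already held by Bob, namely a
correlated random message or a postselected teleportation, happens to be right, and signals the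
result by her choice of encoder. Bob keeps the guess only when his effect fires. A guess right with
probability `1 / d` or `1 / d²` is thereby amplified by `k ^ n`, enough for `d` or `d²` of order `2
^ (n x)` (`protocol_apply`, `conditional_success`).

Since pEA protocols are pNA (`IsPEA.isPNA`), all capacities lie between these two bounds. -/

lemma posSemidef_sum_snd [Fintype ι] [Fintype κ] {M : Op (ι × κ)} (hM : M.PosSemidef) :
    (Matrix.of fun i j => ∑ k, ∑ l, M (i, k) (j, l)).PosSemidef := by
  classical
  convert hM.conjTranspose_mul_mul_same
    (Matrix.of fun (p : ι × κ) (j : ι) => if p.1 = j then (1 : ℂ) else 0) using 1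
  ext i j
  simp only [Matrix.mul_apply, Matrix.conjTranspose_apply, Matrix.of_apply, Fintype.sum_prod_type,
    apply_ite star, star_one, star_zero, ite_mul, one_mul, zero_mul, mul_ite, mul_one, mul_zero]
  rw [Finset.sum_comm]
  simp only [Finset.sum_comm (s := (Finset.univ : Finset ι)) (t := (Finset.univ : Finset κ))]
  simp

lemma posSemidef_hadamard {X Y : Op ι} (hX : X.PosSemidef) (hY : Y.PosSemidef) :
    (X ⊙ Y).PosSemidef := hX.hadamard hY

lemma posSemidef_kronecker [Finite ι] [Finite κ] {X : Op ι} {Y : Op κ} (hX : X.PosSemidef)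
    (hY : Y.PosSemidef) : (X ⊗ₖ Y).PosSemidef := hX.kronecker hY

lemma posSemidef_prod {n : Type*} (s : Finset n) (X : n → Op ι) (f : n → κ → ι)
    (hX : ∀ i ∈ s, (X i).PosSemidef) :
    (Matrix.of fun p q => ∏ i ∈ s, X i (f i p) (f i q)).PosSemidef := by
  classical
  induction s using Finset.induction_on with
  | empty =>
    convert Matrix.posSemidef_vecMulVec_self_star (fun _ : Unit => (1 : ℂ)) |>.submatrix
      (fun _ : κ => ()) using 1
    ext p q
    simp [Matrix.vecMulVec_apply]
  | insert a s ha ih =>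
    convert posSemidef_hadamard ((hX a (by simp)).submatrix (f a))
      (ih fun i hi => hX i (by simp [hi])) using 1
    ext p q
    simp [Finset.prod_insert ha, Matrix.hadamard_apply]

lemma re_trace_nonneg [Fintype ι] {M : Op ι} (hM : M.PosSemidef) : 0 ≤ M.trace.re :=
  (Complex.le_def.1 hM.trace_nonneg).1

lemma posSemidef_vecMulVec [Fintype ι] (v : ι → ℂ) : (Matrix.vecMulVec v (star v)).PosSemidef :=
  Matrix.posSemidef_vecMulVec_self_star v

lemma posSemidef_real_smul {M : Op ι} (hM : M.PosSemidef) {c : ℝ} (hc : 0 ≤ c) :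
    (c • M).PosSemidef := hM.smul hc

lemma exists_eq_conjTranspose_mul_self [Fintype ι] {M : Op ι} (hM : M.PosSemidef) :
    ∃ S : Op ι, M = Sᴴ * S := by
  classical
  open scoped MatrixOrder in
  exact CStarAlgebra.nonneg_iff_eq_star_mul_self.mp hM.nonneg

end PosSemidef

/-! ### Choi matrices and complete positivity -/

section Choi

variable {A B C R : Type*}

/-- The (unnormalized) Choi matrix of a linear map. -/
def choi [DecidableEq A] (N : LMap A B) : Op (A × B) :=
  Matrix.of fun p q => N (Matrix.single p.1 q.1 1) p.2 q.2

/-- The linear map with a given Choi matrix. -/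
def ofChoi [Fintype A] (C : Op (A × B)) : LMap A B where
  toFun X := Matrix.of fun b b' => ∑ a, ∑ a', X a a' * C (a, b) (a', b')
  map_add' X Y := by
    ext b b'
    simp [add_mul, Finset.sum_add_distrib]
  map_smul' c X := by
    ext b b'
    simp [Finset.mul_sum, mul_assoc]

lemma apply_eq_sum_choi [Fintype A] [DecidableEq A] (N : LMap A B) (X : Op A) (b b' : B) :
    N X b b' = ∑ a, ∑ a', X a a' * choi N (a, b) (a', b') := by
  conv_lhs => rw [Matrix.matrix_eq_sum_single X]
  simp only [map_sum, Matrix.sum_apply]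
  refine Finset.sum_congr rfl fun a _ => Finset.sum_congr rfl fun a' _ => ?_
  have : Matrix.single a a' (X a a') = X a a' • Matrix.single a a' (1 : ℂ) := by
    simp [Matrix.smul_single]
  rw [this, map_smul]
  simp [choi]

@[simp] lemma choi_ofChoi [Fintype A] [DecidableEq A] (C : Op (A × B)) : choi (ofChoi C) = C := by
  ext ⟨a, b⟩ ⟨a', b'⟩
  simp [choi, ofChoi, Matrix.single_apply, ite_and]

lemma choi_injective [Fintype A] [DecidableEq A] {N M : LMap A B} (h : choi N = choi M) :
    N = M := by
  refine LinearMap.ext fun X => ?_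
  ext b b'
  simp only [apply_eq_sum_choi, h]

lemma idTensor_apply (N : LMap A B) (X : Op (R × A)) (p q : R × B) :
    idTensor R N X p q = N (Matrix.of fun a a' => X (p.1, a) (q.1, a')) p.2 q.2 := rfl

lemma tensorId_apply (N : LMap A B) (X : Op (A × R)) (p q : B × R) :
    tensorId R N X p q = N (Matrix.of fun a a' => X (a, p.2) (a', q.2)) p.1 q.1 := rfl

/-- The output is a Schur product of `X` and the Choi matrix, both pulled back to `R × B × A`,
compressed by the all-ones vector of `A`. -/
lemma posSemidef_idTensor_of_choi [Fintype A] [DecidableEq A] [Fintype B] [Fintype R]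
    {N : LMap A B} (hN : (choi N).PosSemidef) {X : Op (R × A)} (hX : X.PosSemidef) :
    (idTensor R N X).PosSemidef := by
  convert posSemidef_sum_snd (posSemidef_hadamard
    (hX.submatrix fun p : (R × B) × A => (p.1.1, p.2))
    (hN.submatrix fun p : (R × B) × A => (p.2, p.1.2))) using 1
  ext p q
  rw [idTensor_apply, apply_eq_sum_choi]
  rfl

lemma IsCP.posSemidef_idTensor {N : LMap A B} (hN : IsCP N) [Fintype R] {X : Op (R × A)}
    (hX : X.PosSemidef) : (idTensor R N X).PosSemidef :=
  (hN _ (X.submatrix (Prod.map (Fintype.equivFin R).symm id)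
    (Prod.map (Fintype.equivFin R).symm id)) (hX.submatrix _)).submatrix
    (Prod.map (Fintype.equivFin R) id) |> fun h => by
      convert h using 1
      ext p q
      simp [idTensor_apply, Prod.map]

lemma IsCP.posSemidef_choi [Fintype A] [DecidableEq A] {N : LMap A B} (hN : IsCP N) :
    (choi N).PosSemidef := by
  convert hN.posSemidef_idTensor (R := A)
    (posSemidef_vecMulVec fun p : A × A => if p.1 = p.2 then (1 : ℂ) else 0) using 1
  ext p q
  rw [idTensor_apply, choi, Matrix.of_apply]
  suffices h : Matrix.single p.1 q.1 (1 : ℂ) = Matrix.of fun a a' => Matrix.vecMulVec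
      (fun p : A × A => if p.1 = p.2 then (1 : ℂ) else 0)
      (star fun p : A × A => if p.1 = p.2 then (1 : ℂ) else 0) (p.1, a) (q.1, a') by rw [h]
  ext a a'
  simp only [Matrix.single_apply, Matrix.of_apply, Matrix.vecMulVec_apply, Pi.star_apply,
    apply_ite star, star_one, star_zero]
  split_ifs <;> simp_all

lemma isCP_iff_choi [Fintype A] [DecidableEq A] [Fintype B] {N : LMap A B} :
    IsCP N ↔ (choi N).PosSemidef :=
  ⟨IsCP.posSemidef_choi, fun h _ _ hX => posSemidef_idTensor_of_choi h hX⟩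

lemma IsCP.posSemidef {N : LMap A B} (hN : IsCP N) {X : Op A} (hX : X.PosSemidef) :
    (N X).PosSemidef :=
  (hN.posSemidef_idTensor (R := Unit) (hX.submatrix Prod.snd)).submatrix fun b => ((), b)

lemma IsCP.comp {N : LMap B C} {M : LMap A B} (hN : IsCP N) (hM : IsCP M) : IsCP (N ∘ₗ M) :=
  fun r X hX => hN r _ (hM r X hX)

lemma IsCP.add {N M : LMap A B} (hN : IsCP N) (hM : IsCP M) : IsCP (N + M) :=
  fun r X hX => (hN r X hX).add (hM r X hX)

lemma IsCP.smul {N : LMap A B} (hN : IsCP N) {c : ℝ} (hc : 0 ≤ c) : IsCP (c • N) :=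
  fun r X hX => posSemidef_real_smul (hN r X hX) hc

lemma isCP_idTensor {N : LMap A B} (hN : IsCP N) [Fintype R] : IsCP (idTensor R N) := by
  intro r X hX
  exact (hN.posSemidef_idTensor (hX.submatrix (Equiv.prodAssoc (Fin r) R A))).submatrix
    (Equiv.prodAssoc (Fin r) R B).symm

/-- Relabelling of the computational basis as a linear map. -/
def relabel (f : B → A) : LMap A B where
  toFun X := X.submatrix f f
  map_add' _ _ := rfl
  map_smul' _ _ := rfl

@[simp] lemma relabel_apply (f : B → A) (X : Op A) : relabel f X = X.submatrix f f := rfl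

lemma isCP_relabel (f : B → A) : IsCP (relabel f) :=
  fun _ _ hX => hX.submatrix (Prod.map id f)

lemma tensorId_eq (N : LMap A B) :
    tensorId R N = relabel Prod.swap ∘ₗ idTensor R N ∘ₗ relabel Prod.swap := rfl

lemma trace_idTensor [Fintype R] [Fintype A] [Fintype B] (N : LMap A B) (X : Op (R × A)) :
    (idTensor R N X).trace = ∑ r, (N (Matrix.of fun a a' => X (r, a) (r, a'))).trace := by
  simp [Matrix.trace, Fintype.sum_prod_type, idTensor_apply]

lemma trace_submatrix_equiv [Fintype A] [Fintype B] (e : B ≃ A) (X : Op A) :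
    (X.submatrix e e).trace = X.trace := by
  simpa [Matrix.trace] using e.sum_comp fun a => X a a

end Choi

/-! ### Channels, subchannels, replacers and partial traces. -/

section Channel

variable {A B C R : Type*} [Fintype A] [Fintype B] [Fintype C] [Fintype R]

lemma IsChannel.isSubchannel {N : LMap A B} (hN : IsChannel N) : IsSubchannel N :=
  ⟨hN.1, fun X _ => by rw [hN.2]⟩

lemma IsChannel.comp {N : LMap B C} {M : LMap A B} (hN : IsChannel N) (hM : IsChannel M) :
    IsChannel (N ∘ₗ M) :=
  ⟨hN.1.comp hM.1, fun X => by simp [hN.2, hM.2]⟩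

lemma IsSubchannel.comp {N : LMap B C} {M : LMap A B} (hN : IsSubchannel N)
    (hM : IsSubchannel M) : IsSubchannel (N ∘ₗ M) :=
  ⟨hN.1.comp hM.1, fun X hX => (hN.2 _ (hM.1.posSemidef hX)).trans (hM.2 X hX)⟩

lemma isChannel_idTensor {N : LMap A B} (hN : IsChannel N) : IsChannel (idTensor R N) :=
  ⟨isCP_idTensor hN.1, fun X => by
    rw [trace_idTensor]
    simp [hN.2]
    simp [Matrix.trace, Fintype.sum_prod_type]⟩

lemma isSubchannel_idTensor {N : LMap A B} (hN : IsSubchannel N) :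
    IsSubchannel (idTensor R N) :=
  ⟨isCP_idTensor hN.1, fun X hX => by
    rw [trace_idTensor, Complex.re_sum]
    refine (Finset.sum_le_sum fun r _ => hN.2 _ (hX.submatrix fun a => (r, a))).trans ?_
    simp [Matrix.trace, Fintype.sum_prod_type]⟩

lemma isChannel_relabel {f : B → A} (hf : f.Bijective) : IsChannel (relabel f) :=
  ⟨isCP_relabel f, trace_submatrix_equiv (Equiv.ofBijective f hf)⟩

lemma isChannel_tensorId {N : LMap A B} (hN : IsChannel N) : IsChannel (tensorId R N) := by
  rw [tensorId_eq]
  exact (isChannel_relabel Prod.swap_bijective).comp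
    ((isChannel_idTensor hN).comp (isChannel_relabel Prod.swap_bijective))

/-- The replacer map `X ↦ (Tr X) σ`. -/
def replacer (A : Type*) [Fintype A] (σ : Op B) : LMap A B :=
  (Matrix.traceLinearMap A ℂ ℂ).smulRight σ

@[simp] lemma replacer_apply (σ : Op B) (X : Op A) : replacer A σ X = X.trace • σ := rfl

lemma choi_replacer [DecidableEq A] (σ : Op B) : choi (replacer A σ) = (1 : Op A) ⊗ₖ σ := by
  ext p q
  by_cases h : p.1 = q.1
  · simp [choi, h, Matrix.kroneckerMap_apply, Matrix.one_apply]
  · simp [choi, h, Matrix.kroneckerMap_apply, Matrix.trace_single_eq_of_ne]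

lemma idTensor_replacer (σ : Op B) (X : Op (R × A)) :
    idTensor R (replacer A σ) X = traceSnd X ⊗ₖ σ := by
  ext p q
  simp [idTensor_apply, Matrix.kroneckerMap_apply, traceSnd, Matrix.trace]

lemma traceSnd_idTensor {N : LMap A B} (hN : ∀ X, (N X).trace = X.trace) (X : Op (R × A)) :
    traceSnd (idTensor R N X) = traceSnd X := by
  ext r r'
  exact hN (Matrix.of fun a a' => X (r, a) (r', a'))

lemma trace_traceSnd (X : Op (A × B)) : (traceSnd X).trace = X.trace := by
  simp [traceSnd, Matrix.trace, Fintype.sum_prod_type]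

lemma trace_traceFst (X : Op (A × B)) : (traceFst X).trace = X.trace := by
  simp [traceFst, Matrix.trace, Fintype.sum_prod_type_right]

lemma traceFst_posSemidef {X : Op (A × B)} (hX : X.PosSemidef) : (traceFst X).PosSemidef := by
  convert Matrix.posSemidef_sum Finset.univ
    fun a (_ : a ∈ Finset.univ) => hX.submatrix fun b : B => (a, b) using 1
  ext b b'
  simp [traceFst, Matrix.sum_apply]

end Channel

/-! ### Supermaps implemented by an encoder, a decoder and a memory -/

section Assisted

variable {A B M M' α β R S : Type*} [Fintype A] [Fintype B] [Fintype M] [Fintype M'] [Fintype α]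
  [Fintype β]

/-- Appending a shared state `γ` to a message. -/
def append (M : Type*) (γ : Op (α × β)) : LMap M ((M × α) × β) where
  toFun ρ := (ρ ⊗ₖ γ).submatrix (Equiv.prodAssoc M α β) (Equiv.prodAssoc M α β)
  map_add' X Y := by
    ext p q
    simp [Matrix.kroneckerMap_apply, add_mul]
  map_smul' c X := by
    ext p q
    simp [Matrix.kroneckerMap_apply, mul_assoc]

lemma append_apply (γ : Op (α × β)) (ρ : Op M) (p q : (M × α) × β) :
    append M γ ρ p q = ρ p.1.1 q.1.1 * γ (p.1.2, p.2) (q.1.2, q.2) := rfl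

lemma isCP_append {γ : Op (α × β)} (hγ : γ.PosSemidef) : IsCP (append M γ) := by
  intro r X hX
  exact posSemidef_hadamard
    (hX.submatrix fun p : Fin r × ((M × α) × β) => (p.1, p.2.1.1))
    (hγ.submatrix fun p : Fin r × ((M × α) × β) => (p.2.1.2, p.2.2))

lemma isChannel_append {γ : Op (α × β)} (hγ : IsState γ) : IsChannel (append M γ) := by
  refine ⟨isCP_append hγ.1, fun X => ?_⟩
  have h := trace_submatrix_equiv (Equiv.prodAssoc M α β) (X ⊗ₖ γ)
  rw [Matrix.trace_kronecker, hγ.2, mul_one] at h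
  exact h

/-- Appending a shared state and applying a local encoder to Alice's part. -/
def encode (γ : Op (α × β)) (E : LMap (M × α) A) : LMap M (A × β) :=
  tensorId β E ∘ₗ append M γ

lemma isChannel_encode {γ : Op (α × β)} {E : LMap (M × α) A} (hγ : IsState γ)
    (hE : IsChannel E) : IsChannel (encode γ E) :=
  (isChannel_tensorId hE).comp (isChannel_append hγ)

lemma traceFst_encode {γ : Op (α × β)} {E : LMap (M × α) A} (hE : IsChannel E) (ρ : Op M) :
    traceFst (encode γ E ρ) = ρ.trace • traceFst γ := by
  ext y y'
  refine (hE.2 (Matrix.of fun a a' => append M γ ρ (a, y) (a', y'))).trans ?_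
  simp [Matrix.trace, append_apply, Fintype.sum_prod_type, traceFst, Finset.sum_mul_sum]

/-- The supermap `N ↦ D ∘ (N ⊗ id) ∘ W`. -/
def assisted (W : LMap M (A × β)) (D : LMap (B × β) M') : Supermap A B M M' where
  toFun N := D ∘ₗ tensorId β N ∘ₗ W
  map_add' N N' := by
    ext1 ρ
    simp only [LinearMap.comp_apply, LinearMap.add_apply]
    rw [← map_add]
    congr 1
  map_smul' c N := by
    ext1 ρ
    simp only [LinearMap.comp_apply, LinearMap.smul_apply, RingHom.id_apply]
    rw [← map_smul]
    congr 1

lemma assisted_apply (W : LMap M (A × β)) (D : LMap (B × β) M') (N : LMap A B) (ρ : Op M) :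
    assisted W D N ρ = D (tensorId β N (W ρ)) := rfl

lemma sum_single_kronecker [Fintype R] [DecidableEq R] (X : Op (R × A)) :
    (∑ r, ∑ r', Matrix.single r r' (1 : ℂ) ⊗ₖ Matrix.of fun a a' => X (r, a) (r', a')) = X := by
  ext p q
  simp [Matrix.sum_apply, Matrix.kroneckerMap_apply, Matrix.single_apply, ite_and]

/-- Up to reassociating tensor factors, the extension is again encoder, then `K`, then decoder. Both
supermap properties thus reduce to composing channels and subchannels. -/
lemma extend_assisted [Fintype R] [DecidableEq R] (W : LMap M (A × β)) (D : LMap (B × β) M')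
    (K : LMap (R × A) (S × B)) :
    (assisted W D).extend R S K = idTensor S D ∘ₗ relabel (Equiv.prodAssoc S B β).symm ∘ₗ
      tensorId β K ∘ₗ relabel (Equiv.prodAssoc R A β) ∘ₗ idTensor R W := by
  refine LinearMap.ext fun Z => ?_
  ext p q
  -- Linearity of `K` reassembles its blocks, by expanding the `R` factor in matrix units.
  have key : (∑ r, ∑ r', tensorId β (block K r r' p.1 q.1)
      (W (Matrix.of fun m m' => Z (r, m) (r', m')))) =
      Matrix.of fun x x' => relabel (Equiv.prodAssoc S B β).symm
        (tensorId β K (relabel (Equiv.prodAssoc R A β) (idTensor R W Z))) (p.1, x) (q.1, x') := by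
    ext x x'
    have h := congrFun (congrFun (congrArg K (sum_single_kronecker (R := R) (A := A)
      (Matrix.of fun y y' => idTensor R W Z (y.1, (y.2, x.2)) (y'.1, (y'.2, x'.2)))))
        (p.1, x.1)) (q.1, x'.1)
    simp only [map_sum, Matrix.sum_apply] at h ⊢
    exact h
  calc (assisted W D).extend R S K Z p q
      = ∑ r, ∑ r', D (tensorId β (block K r r' p.1 q.1)
          (W (Matrix.of fun m m' => Z (r, m) (r', m')))) p.2 q.2 := rfl
    _ = D (∑ r, ∑ r', tensorId β (block K r r' p.1 q.1)
          (W (Matrix.of fun m m' => Z (r, m) (r', m')))) p.2 q.2 := by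
        simp only [map_sum, Matrix.sum_apply]
    _ = _ := by
        rw [key]
        rfl

lemma isSuperchannel_assisted {W : LMap M (A × β)} {D : LMap (B × β) M'} (hW : IsChannel W)
    (hD : IsChannel D) : IsSuperchannel (assisted W D) := by
  intro r s K hK
  rw [extend_assisted]
  exact (isChannel_idTensor hD).comp ((isChannel_relabel (Equiv.bijective _)).comp
    ((isChannel_tensorId hK).comp ((isChannel_relabel (Equiv.bijective _)).comp
      (isChannel_idTensor hW))))

lemma isProbSupermap_assisted {W : LMap M (A × β)} {D : LMap (B × β) M'} (hW : IsChannel W)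
    (hD : IsSubchannel D) : IsProbSupermap (assisted W D) := by
  intro r s K hK
  rw [extend_assisted]
  exact (isSubchannel_idTensor hD).comp (((isChannel_relabel (Equiv.bijective _)).comp
    ((isChannel_tensorId hK).comp ((isChannel_relabel (Equiv.bijective _)).comp
      (isChannel_idTensor hW)))).isSubchannel)

/-- Only a relabelling: the definition requires memories of the form `Fin a`, whereas constructions
use arbitrary finite types. -/
lemma isPEA_assisted {γ : Op (α × β)} {E : LMap (M × α) A} {D : LMap (B × β) M'}
    (hγ : IsState γ) (hE : IsChannel E) (hD : IsSubchannel D) :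
    IsPEA (assisted (encode γ E) D) := by
  refine ⟨isProbSupermap_assisted (isChannel_encode hγ hE) hD, Fintype.card α, Fintype.card β,
    γ.submatrix (Equiv.prodCongr (Fintype.equivFin α).symm (Fintype.equivFin β).symm)
      (Equiv.prodCongr (Fintype.equivFin α).symm (Fintype.equivFin β).symm),
    E ∘ₗ relabel (Prod.map id (Fintype.equivFin α)),
    D ∘ₗ relabel (Prod.map id (Fintype.equivFin β)),
    ⟨hγ.1.submatrix _, (trace_submatrix_equiv _ γ).trans hγ.2⟩,
    hE.comp (isChannel_relabel (Function.bijective_id.prodMap (Equiv.bijective _))),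
    hD.comp (isChannel_relabel
      (Function.bijective_id.prodMap (Equiv.bijective _))).isSubchannel, fun N ρ => ?_⟩
  rw [assisted_apply, LinearMap.comp_apply]
  congr 1
  ext p q
  refine congrFun (congrFun (congrArg N ?_) p.1) q.1
  ext a a'
  refine congrFun (congrFun (congrArg E ?_) a) a'
  ext x x'
  simp [append_apply, Matrix.kroneckerMap_apply]

end Assisted

/-! ### Entanglement-assisted protocols are nonsignalling -/

section NonSignalling

variable {A B M M' : Type*} [Fintype A] [Fintype B] [Fintype M] [Fintype M']

/-- Discarding Alice's output `A` while Bob receives `σ` is the same as using the replacer as the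
channel. Nonsignalling thereby becomes a statement about the action of `Θ` on replacers. -/
lemma traceFst_bipartite [DecidableEq B] [DecidableEq M] (Θ : Supermap A B M M') (ρ : Op M)
    (σ : Op B) : traceFst (Θ.bipartite (ρ ⊗ₖ σ)) = Θ (replacer A σ) ρ := by
  have hσ : replacer A σ = ∑ a : A, ∑ b, ∑ b', σ b b' •
      (Matrix.entryLinearMap ℂ ℂ a a).smulRight (Matrix.single b b' (1 : ℂ)) := by
    refine LinearMap.ext fun X => ?_
    ext c c'
    simp [LinearMap.sum_apply, Matrix.sum_apply, Matrix.trace, Matrix.single_apply, ite_and,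
      Finset.mul_sum, mul_comm]
  have hρ : ρ = ∑ i, ∑ j, ρ i j • Matrix.single i j (1 : ℂ) := by
    conv_lhs => rw [Matrix.matrix_eq_sum_single ρ]
    simp [Matrix.smul_single]
  ext m m'
  calc traceFst (Θ.bipartite (ρ ⊗ₖ σ)) m m'
      = ∑ a : A, ∑ i, ∑ j, ∑ b, ∑ b', ρ i j * σ b b' *
          Θ ((Matrix.entryLinearMap ℂ ℂ a a).smulRight (Matrix.single b b' (1 : ℂ)))
            (Matrix.single i j 1) m m' := rfl
    _ = Θ (replacer A σ) (∑ i, ∑ j, ρ i j • Matrix.single i j (1 : ℂ)) m m' := by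
        simp only [hσ, map_sum, map_smul, LinearMap.sum_apply, LinearMap.smul_apply,
          Matrix.sum_apply, Matrix.smul_apply, smul_eq_mul, Finset.mul_sum, mul_assoc]
        rw [Finset.sum_comm]
        refine Finset.sum_congr rfl fun i _ => Finset.sum_comm
    _ = Θ (replacer A σ) ρ m m' := by rw [← hρ]

lemma isCP_smulRight [DecidableEq A] {f : Op A →ₗ[ℂ] ℂ} {τ : Op B}
    (hf : (Matrix.of fun a a' => f (Matrix.single a a' 1)).PosSemidef) (hτ : τ.PosSemidef) :
    IsCP (f.smulRight τ) := by
  rw [isCP_iff_choi]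
  exact posSemidef_kronecker hf hτ

/-- The probability defect of a subchannel. -/
def traceDefect (D : LMap A B) : Op A →ₗ[ℂ] ℂ :=
  Matrix.traceLinearMap A ℂ ℂ - Matrix.traceLinearMap B ℂ ℂ ∘ₗ D

lemma traceDefect_apply (D : LMap A B) (X : Op A) :
    traceDefect D X = X.trace - (D X).trace := rfl

lemma traceDefect_nonneg {D : LMap A B} (hD : IsSubchannel D) {X : Op A} (hX : X.PosSemidef) :
    0 ≤ traceDefect D X := by
  have h1 := Complex.le_def.1 hX.trace_nonneg
  have h2 := Complex.le_def.1 (hD.1.posSemidef hX).trace_nonneg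
  have h3 := hD.2 X hX
  rw [traceDefect_apply, Complex.le_def]
  simp only [Complex.zero_re, Complex.zero_im, Complex.sub_re, Complex.sub_im] at *
  exact ⟨by linarith, by rw [← h1.2, ← h2.2, sub_zero]⟩

lemma posSemidef_traceDefect [DecidableEq A] {D : LMap A B} (hD : IsSubchannel D) :
    (Matrix.of fun a a' => traceDefect D (Matrix.single a a' 1)).PosSemidef := by
  have heq : (Matrix.of fun a a' => traceDefect D (Matrix.single a a' 1)) =
      1 - traceSnd (choi D) := by
    ext a a'
    by_cases h : a = a'
    · simp [traceDefect_apply, traceSnd, choi, h, Matrix.trace_single_eq_same,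
        Matrix.trace.eq_1 (D _)]
    · simp [traceDefect_apply, traceSnd, choi, h, Matrix.trace_single_eq_of_ne,
        Matrix.trace.eq_1 (D _)]
  refine Matrix.PosSemidef.of_dotProduct_mulVec_nonneg ?_ fun v => ?_
  · rw [heq]
    refine Matrix.isHermitian_one.sub ?_
    ext a a'
    simpa [traceSnd] using Finset.sum_congr rfl fun b _ =>
      hD.1.posSemidef_choi.isHermitian.apply (a, b) (a', b)
  -- The quadratic form at `v` is the trace defect of the rank-one operator of `star v`; the
  -- conjugate comes from the transpose in the pairing with matrix units.
  · have h := traceDefect_nonneg hD (posSemidef_vecMulVec (star v))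
    rw [Matrix.matrix_eq_sum_single (Matrix.vecMulVec (star v) (star (star v)))] at h
    convert h using 1
    simp only [map_sum, dotProduct, Matrix.mulVec, Matrix.of_apply, Finset.mul_sum]
    refine Finset.sum_congr rfl fun a _ => Finset.sum_congr rfl fun a' _ => ?_
    have : Matrix.single a a' (Matrix.vecMulVec (star v) (star (star v)) a a') =
        (star v a * v a') • Matrix.single a a' (1 : ℂ) := by
      simp [Matrix.smul_single, Matrix.vecMulVec_apply]
    rw [this, map_smul, smul_eq_mul]
    ring

/-- A subchannel completed to a channel with a flag: flag `0` on success, and a fixed state `τ` with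
flag `1` on failure. -/
def complete (D : LMap A B) (τ : Op B) : LMap A (B × Fin 2) where
  toFun X := D X ⊗ₖ Matrix.single 0 0 1 + traceDefect D X • (τ ⊗ₖ Matrix.single 1 1 1)
  map_add' X Y := by
    simp only [map_add, Matrix.add_kronecker, add_smul]
    abel
  map_smul' c X := by
    simp [Matrix.smul_kronecker, mul_smul]

lemma posSemidef_single [DecidableEq A] (a : A) : (Matrix.single a a (1 : ℂ)).PosSemidef := by
  convert posSemidef_vecMulVec (Pi.single a (1 : ℂ)) using 1
  ext i j
  by_cases hi : a = i <;> by_cases hj : a = j <;>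
    simp [Matrix.vecMulVec_apply, Matrix.single_apply, Pi.single_apply, hi, hj, eq_comm]

lemma isChannel_complete {D : LMap A B} (hD : IsSubchannel D) {τ : Op B} (hτ : IsState τ) :
    IsChannel (complete D τ) := by
  classical
  refine ⟨?_, fun X => ?_⟩
  · rw [isCP_iff_choi]
    exact ((posSemidef_kronecker hD.1.posSemidef_choi (posSemidef_single (0 : Fin 2))).submatrix
      (Equiv.prodAssoc A B (Fin 2)).symm).add
      (isCP_smulRight (posSemidef_traceDefect hD)
        (posSemidef_kronecker hτ.1 (posSemidef_single (1 : Fin 2)))).posSemidef_choi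
  · simp [complete, Matrix.trace_kronecker, hτ.2, traceDefect_apply]

/-- A compression to a subset of basis vectors keeps only part of a nonnegative diagonal. The case
`m ↦ (m, 0)` is postselection on flag `0`. -/
lemma isSubchannel_relabel_injective {f : B → A} (hf : f.Injective) :
    IsSubchannel (relabel f : LMap A B) := by
  classical
  refine ⟨isCP_relabel f, fun X hX => ?_⟩
  have h : (X.submatrix f f).trace.re = ∑ a ∈ Finset.univ.map ⟨f, hf⟩, (X a a).re := by
    simp [Matrix.trace]
  rw [relabel_apply, h, Matrix.trace, Complex.re_sum]
  exact Finset.sum_le_sum_of_subset_of_nonneg (Finset.subset_univ _)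
    fun a _ _ => (Complex.le_def.1 (hX.diag_nonneg (i := a))).1

lemma tensorId_replacer {β : Type*} (σ : Op B) (X : Op (A × β)) :
    tensorId β (replacer A σ) X = σ ⊗ₖ traceFst X := by
  ext p q
  simp [tensorId_apply, Matrix.kroneckerMap_apply, traceFst, Matrix.trace, mul_comm]

/-- Completing the decoder by a flag gives a superchannel, and postselecting on flag `0` recovers
the original protocol. It is nonsignalling because a replacer discards Alice's system, leaving Bob
with his marginal of `γ`, which does not depend on the message. -/
lemma IsPEA.isPNA [DecidableEq B] [DecidableEq M] [Nonempty M'] {Θ : Supermap A B M M'}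
    (h : IsPEA Θ) : IsPNA Θ := by
  classical
  obtain ⟨hΘ, a, b, γ, E, D, hγ, hE, hD, hEq⟩ := h
  obtain ⟨m₀⟩ := ‹Nonempty M'›
  have hτ : IsState (Matrix.single m₀ m₀ (1 : ℂ)) := ⟨posSemidef_single m₀, by simp⟩
  refine ⟨hΘ, assisted (encode γ E) (complete D (Matrix.single m₀ m₀ 1)),
    relabel fun m => (m, 0), ⟨isSuperchannel_assisted (isChannel_encode hγ hE)
      (isChannel_complete hD hτ), fun ρ ω σ hρ hω _ => ?_⟩,
    isSubchannel_relabel_injective fun m m' h => (Prod.ext_iff.1 h).1, fun N ρ => ?_⟩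
  · simp only [traceFst_bipartite, assisted_apply, tensorId_replacer, traceFst_encode hE, hρ.2,
      hω.2]
  · rw [hEq, assisted_apply]
    ext m m'
    simp [complete, Matrix.kroneckerMap_apply, encode, append]

end NonSignalling

/-! ### Tensor powers -/

section TensorPow

variable {A B C ι κ : Type*} [Fintype A] [DecidableEq A] [Fintype B] [DecidableEq B] [Fintype C]
  [DecidableEq C]

/-- Tensor powers are monotone on positive operators, by the telescoping `X ⊗ X' - Y ⊗ Y' = X ⊗ (X'
- Y') + (X - Y) ⊗ Y'` with `X'`, `Y'` the remaining factors. -/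
lemma posSemidef_prod_sub [Finite ι] {n : Type*} (s : Finset n) {X Y : Op ι} (f : n → κ → ι)
    (hY : Y.PosSemidef) (hXY : (X - Y).PosSemidef) :
    ((Matrix.of fun p q => ∏ i ∈ s, X (f i p) (f i q)) -
      Matrix.of fun p q => ∏ i ∈ s, Y (f i p) (f i q)).PosSemidef := by
  classical
  have hX : X.PosSemidef := by simpa using hXY.add hY
  induction s using Finset.induction_on with
  | empty =>
    convert Matrix.PosSemidef.zero using 1
    ext p q
    simp
  | insert a s ha ih =>
    convert (posSemidef_hadamard (hX.submatrix (f a)) ih).add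
      (posSemidef_hadamard (hXY.submatrix (f a))
        (posSemidef_prod s (fun _ => Y) f fun _ _ => hY)) using 1
    ext p q
    simp only [Matrix.sub_apply, Matrix.of_apply, Matrix.add_apply, Matrix.hadamard_apply,
      Matrix.submatrix_apply, Finset.prod_insert ha]
    ring

lemma sum_prod_pi {n : ℕ} (f : Fin n → A → ℂ) :
    ∑ x : Fin n → A, ∏ i, f i (x i) = ∏ i, ∑ a, f i a := by
  rw [Finset.prod_univ_sum, Fintype.piFinset_univ]

/-- Tensor power of an operator. -/
def opPow (n : ℕ) (X : Op A) : Op (Fin n → A) := Matrix.of fun a a' => ∏ i, X (a i) (a' i)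

lemma trace_opPow (n : ℕ) (X : Op A) : (opPow n X).trace = X.trace ^ n := by
  refine (sum_prod_pi fun _ a => X a a).trans ?_
  simp [Matrix.trace]

lemma isState_opPow (n : ℕ) {σ : Op A} (hσ : IsState σ) : IsState (opPow n σ) :=
  ⟨posSemidef_prod Finset.univ (fun _ => σ) (fun (i : Fin n) (a : Fin n → A) => a i)
    fun _ _ => hσ.1, by
    rw [trace_opPow, hσ.2, one_pow]⟩

lemma tensorPow_single (n : ℕ) (N : LMap A B) (a a' : Fin n → A) (b b' : Fin n → B) :
    tensorPow n N (Matrix.single a a' 1) b b' =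
      ∏ i, N (Matrix.single (a i) (a' i) 1) (b i) (b' i) := by
  simp [tensorPow, Matrix.single_apply, ite_and]

lemma choi_tensorPow (n : ℕ) (N : LMap A B) (p q : (Fin n → A) × (Fin n → B)) :
    choi (tensorPow n N) p q = ∏ i, choi N (p.1 i, p.2 i) (q.1 i, q.2 i) :=
  tensorPow_single n N _ _ _ _

/-- On Choi matrices, composition sums over the intermediate indices, and a product of such sums is
the sum over strings of indices. -/
lemma tensorPow_comp (n : ℕ) (N : LMap B C) (E : LMap A B) :
    tensorPow n (N ∘ₗ E) = tensorPow n N ∘ₗ tensorPow n E := by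
  refine choi_injective ?_
  ext ⟨a, c⟩ ⟨a', c'⟩
  have h : ∀ i, (N ∘ₗ E) (Matrix.single (a i) (a' i) 1) (c i) (c' i) =
      ∑ b : B × B, E (Matrix.single (a i) (a' i) 1) b.1 b.2 *
        N (Matrix.single b.1 b.2 1) (c i) (c' i) := fun i => by
    rw [LinearMap.comp_apply, apply_eq_sum_choi, Fintype.sum_prod_type]
    rfl
  rw [choi_tensorPow]
  simp only [choi, Matrix.of_apply, LinearMap.comp_apply (f := tensorPow n N)]
  rw [apply_eq_sum_choi (tensorPow n N)]
  simp only [h, tensorPow_single, choi, Matrix.of_apply]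
  rw [Finset.prod_univ_sum, Fintype.piFinset_univ, ← Fintype.sum_prod_type']
  refine Fintype.sum_equiv (Equiv.arrowProdEquivProdArrow (Fin n) (fun _ => B) (fun _ => B)) _ _
    fun x => ?_
  rw [Finset.prod_mul_distrib]
  rfl

lemma isChannel_tensorPow (n : ℕ) {N : LMap A B} (hN : IsChannel N) :
    IsChannel (tensorPow n N) := by
  refine ⟨?_, fun X => ?_⟩
  · rw [isCP_iff_choi]
    convert posSemidef_prod Finset.univ (fun _ => choi N)
      (fun (i : Fin n) (p : (Fin n → A) × (Fin n → B)) => (p.1 i, p.2 i))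
      fun _ _ => hN.1.posSemidef_choi using 1
    ext p q
    exact choi_tensorPow n N p q
  · have h : ∀ a a', (tensorPow n N (Matrix.single a a' 1)).trace =
        (Matrix.single a a' (1 : ℂ)).trace := by
      intro a a'
      have h1 : ∀ i, ∑ b, N (Matrix.single (a i) (a' i) 1) b b = if a i = a' i then 1 else 0 := by
        intro i
        refine (hN.2 _).trans ?_
        split_ifs with h
        · rw [h, Matrix.trace_single_eq_same]
        · rw [Matrix.trace_single_eq_of_ne _ _ _ h]
      calc (tensorPow n N (Matrix.single a a' 1)).trace
          = ∑ b : Fin n → B, ∏ i, N (Matrix.single (a i) (a' i) 1) (b i) (b i) := by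
            simp only [Matrix.trace, Matrix.diag_apply, tensorPow_single]
        _ = ∏ i, if a i = a' i then (1 : ℂ) else 0 := by
            rw [sum_prod_pi fun i b => N (Matrix.single (a i) (a' i) 1) b b]
            simp only [h1]
        _ = _ := by
            by_cases h : a = a'
            · simp [h]
            · obtain ⟨i, hi⟩ := Function.ne_iff.1 h
              rw [Matrix.trace_single_eq_of_ne _ _ _ h, Finset.prod_eq_zero (Finset.mem_univ i)]
              simp [hi]
    have h2 : Matrix.traceLinearMap (Fin n → B) ℂ ℂ ∘ₗ tensorPow n N =
        Matrix.traceLinearMap (Fin n → A) ℂ ℂ := by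
      refine LinearMap.ext fun X => ?_
      rw [Matrix.matrix_eq_sum_single X]
      simp only [map_sum]
      refine Finset.sum_congr rfl fun a _ => Finset.sum_congr rfl fun a' _ => ?_
      have : Matrix.single a a' (X a a') = X a a' • Matrix.single a a' (1 : ℂ) := by
        simp [Matrix.smul_single]
      rw [this, map_smul, map_smul]
      congr 1
      exact h a a'
    exact LinearMap.congr_fun h2 X

end TensorPow

/-! ### Comparison with replacer channels -/

section Comparison

variable {A B : Type*} [Fintype A] [DecidableEq A] [Fintype B] [DecidableEq B]

/-- `N ≤ k R_σ` and `R_σ ≤ l N` in the order of complete positivity, where `R_σ` is the replacer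
channel with output `σ`. -/
structure IsComparable (N : LMap A B) (σ : Op B) (k l : ℝ) : Prop where
  left : IsCP (k • replacer A σ - N)
  right : IsCP (l • N - replacer A σ)

lemma isComparable_iff {N : LMap A B} {σ : Op B} {k l : ℝ} :
    IsComparable N σ k l ↔ (k • ((1 : Op A) ⊗ₖ σ) - choi N).PosSemidef ∧
      (l • choi N - (1 : Op A) ⊗ₖ σ).PosSemidef := by
  have h1 : choi (k • replacer A σ - N) = k • ((1 : Op A) ⊗ₖ σ) - choi N := by
    rw [← choi_replacer]
    rfl
  have h2 : choi (l • N - replacer A σ) = l • choi N - (1 : Op A) ⊗ₖ σ := by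
    rw [← choi_replacer]
    rfl
  rw [← h1, ← h2, ← isCP_iff_choi, ← isCP_iff_choi]
  exact ⟨fun h => ⟨h.1, h.2⟩, fun h => ⟨h.1, h.2⟩⟩

lemma IsComparable.tensorPow {N : LMap A B} (hN : IsCP N) {σ : Op B} (hσ : σ.PosSemidef)
    {k l : ℝ} (h : IsComparable N σ k l) (n : ℕ) :
    IsComparable (tensorPow n N) (opPow n σ) (k ^ n) (l ^ n) := by
  have h1 : ∀ p q : (Fin n → A) × (Fin n → B), ((1 : Op (Fin n → A)) ⊗ₖ opPow n σ) p q =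
      ∏ i, ((1 : Op A) ⊗ₖ σ) (p.1 i, p.2 i) (q.1 i, q.2 i) := by
    intro p q
    simp only [Matrix.kroneckerMap_apply, Finset.prod_mul_distrib, opPow, Matrix.of_apply]
    congr 1
    by_cases h : p.1 = q.1
    · rw [h]
      simp only [Matrix.one_apply_eq, Finset.prod_const_one]
    · obtain ⟨i, hi⟩ := Function.ne_iff.1 h
      rw [Matrix.one_apply_ne h]
      have h0 : (1 : Op A) (p.1 i) (q.1 i) = 0 := Matrix.one_apply_ne hi
      exact (Finset.prod_eq_zero (Finset.mem_univ i) h0).symm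
  rw [isComparable_iff] at h ⊢
  constructor
  · convert posSemidef_prod_sub Finset.univ
      (fun (i : Fin n) (p : (Fin n → A) × (Fin n → B)) => (p.1 i, p.2 i))
      hN.posSemidef_choi h.1 using 1
    ext p q
    simp only [Matrix.sub_apply, Matrix.smul_apply, Matrix.of_apply, choi_tensorPow, h1,
      Complex.real_smul, Finset.prod_mul_distrib, Finset.prod_const, Finset.card_univ,
      Fintype.card_fin, Complex.ofReal_pow]
  · convert posSemidef_prod_sub Finset.univ
      (fun (i : Fin n) (p : (Fin n → A) × (Fin n → B)) => (p.1 i, p.2 i))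
      (posSemidef_kronecker Matrix.PosSemidef.one hσ) h.2 using 1
    ext p q
    simp only [Matrix.sub_apply, Matrix.smul_apply, Matrix.of_apply, choi_tensorPow, h1,
      Complex.real_smul, Finset.prod_mul_distrib, Finset.prod_const, Finset.card_univ,
      Fintype.card_fin, Complex.ofReal_pow]

end Comparison

/-! ### Maximally entangled states -/

section MaxEnt

variable {R A B : Type*} [Fintype R] [Fintype A] [DecidableEq A] [Fintype B]

/-- The vector of the maximally entangled state of two systems identified by `e`. -/
def maxEntVec (e : R ≃ A) : R × A → ℂ :=
  fun p => if e p.1 = p.2 then (((√(Fintype.card A : ℝ))⁻¹ : ℝ) : ℂ) else 0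

/-- The maximally entangled state of two systems identified by `e`. -/
def maxEnt (e : R ≃ A) : Op (R × A) := Matrix.vecMulVec (maxEntVec e) (star (maxEntVec e))

lemma inv_sqrt_card_mul_self :
    (((√(Fintype.card A : ℝ))⁻¹ : ℝ) : ℂ) * (((√(Fintype.card A : ℝ))⁻¹ : ℝ) : ℂ) =
      (Fintype.card A : ℂ)⁻¹ := by
  rw [← Complex.ofReal_mul, ← mul_inv, Real.mul_self_sqrt (Nat.cast_nonneg _)]
  simp

lemma maxEnt_apply (e : R ≃ A) (p q : R × A) : maxEnt e p q =
    if e p.1 = p.2 then (if e q.1 = q.2 then (Fintype.card A : ℂ)⁻¹ else 0) else 0 := by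
  rw [maxEnt, Matrix.vecMulVec_apply, Pi.star_apply, maxEntVec, maxEntVec]
  split_ifs
  · rw [← inv_sqrt_card_mul_self]
    simp
  all_goals simp

lemma posSemidef_maxEnt (e : R ≃ A) : (maxEnt e).PosSemidef := posSemidef_vecMulVec _

lemma traceSnd_maxEnt [DecidableEq R] (e : R ≃ A) :
    traceSnd (maxEnt e) = (Fintype.card A : ℂ)⁻¹ • 1 := by
  ext r r'
  by_cases h : r = r'
  · simp [traceSnd, maxEnt_apply, h]
  · have h' : ¬r' = r := fun h' => h h'.symm
    simp [traceSnd, maxEnt_apply, h, h']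

lemma isState_maxEnt [Nonempty A] (e : R ≃ A) : IsState (maxEnt e) := by
  classical
  refine ⟨posSemidef_maxEnt e, ?_⟩
  rw [← trace_traceSnd, traceSnd_maxEnt, Matrix.trace_smul, Matrix.trace_one, Fintype.card_congr e]
  simp

/-- This is the bridge from the entropic quantity, which speaks of output states, to Choi matrices.
-/
lemma idTensor_maxEnt (e : R ≃ A) (N : LMap A B) :
    idTensor R N (maxEnt e) = ((Fintype.card A : ℝ)⁻¹ • choi N).submatrix
      (Prod.map e id) (Prod.map e id) := by
  ext p q
  have : (Matrix.of fun a a' => maxEnt e (p.1, a) (q.1, a')) =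
      (Fintype.card A : ℂ)⁻¹ • Matrix.single (e p.1) (e q.1) (1 : ℂ) := by
    ext a a'
    simp [maxEnt_apply, Matrix.single_apply, ite_and]
  rw [idTensor_apply, this, map_smul]
  simp [choi]

lemma sum_norm_maxEntVec [Nonempty A] (e : R ≃ A) : ∑ i, ‖maxEntVec e i‖ ^ 2 = 1 := by
  have h := (isState_maxEnt e).2
  rw [maxEnt, Matrix.trace_vecMulVec, dotProduct] at h
  rw [← Complex.ofReal_inj, Complex.ofReal_one, ← h, Complex.ofReal_sum]
  refine Finset.sum_congr rfl fun i _ => ?_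
  rw [Pi.star_apply, Complex.star_def, Complex.mul_conj, Complex.normSq_eq_norm_sq]

end MaxEnt

/-! ### Converse -/

section Converse

variable {A B M M' : Type*} [Fintype A] [Fintype B] [Fintype M] [Fintype M']

lemma IsProbSupermap.isSubchannel {Θ : Supermap A B M M'} (hΘ : IsProbSupermap Θ)
    {K : LMap A B} (hK : IsChannel K) : IsSubchannel (Θ K) := by
  have h := hΘ 1 1 (idTensor (Fin 1) K) (isChannel_idTensor hK)
  have hb : block (idTensor (Fin 1) K) 0 0 0 0 = K := by
    refine LinearMap.ext fun X => ?_
    ext b b'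
    refine congrFun (congrFun (congrArg K ?_) b) b'
    ext a a'
    simp [Matrix.kroneckerMap_apply]
  have heq : Θ K = relabel (fun m : M' => ((0 : Fin 1), m)) ∘ₗ
      Θ.extend (Fin 1) (Fin 1) (idTensor (Fin 1) K) ∘ₗ relabel (fun p : Fin 1 × M => p.2) := by
    refine LinearMap.ext fun X => ?_
    ext m m'
    simp only [LinearMap.comp_apply, relabel_apply, Matrix.submatrix_apply, Supermap.extend,
      LinearMap.coe_mk, AddHom.coe_mk, Matrix.of_apply, Finset.univ_unique, Finset.sum_singleton]
    exact congrFun (congrFun (congrArg (fun L => Θ L X) hb.symm) m) m'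
  rw [heq]
  exact (isSubchannel_relabel_injective fun _ _ h => (Prod.ext_iff.1 h).2).comp
    (h.comp (isChannel_relabel ⟨fun p q h => Prod.ext (Subsingleton.elim _ _) h,
      fun m => ⟨(0, m), rfl⟩⟩).isSubchannel)

/-- Such a map is a nonnegative multiple of a channel, to which the definition of a probabilistic
supermap applies. The differences `k R_σ - N` and `l N - R_σ` are of this kind, and no other
completely positive maps are needed. -/
lemma IsProbSupermap.isCP {Θ : Supermap A B M M'} (hΘ : IsProbSupermap Θ)
    {K : LMap A B} (hK : IsCP K) {c : ℝ} (hc : ∀ X, (K X).trace = c * X.trace) :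
    IsCP (Θ K) := by
  classical
  have hzero : IsCP (0 : LMap M M') := fun _ _ _ => by
    convert Matrix.PosSemidef.zero using 1
    ext
    rfl
  rcases lt_trichotomy c 0 with hneg | rfl | hpos
  · rcases isEmpty_or_nonempty A with hA | ⟨⟨a⟩⟩
    · have : K = 0 := LinearMap.ext fun X => by
        rw [Subsingleton.elim X 0, map_zero, map_zero]
      simpa [this] using hzero
    · have h := re_trace_nonneg (hK.posSemidef (posSemidef_single a))
      rw [hc] at h
      simp at h
      linarith
  · have h : choi K = 0 := by
      rw [← hK.posSemidef_choi.trace_eq_zero_iff]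
      have h : (choi K).trace = ∑ a, (K (Matrix.single a a 1)).trace := by
        simp [Matrix.trace, Fintype.sum_prod_type, choi]
      rw [h]
      simp [hc]
    have : K = 0 := choi_injective h
    simpa [this] using hzero
  · have h : IsChannel (c⁻¹ • K) := ⟨hK.smul (inv_nonneg.2 hpos.le), fun X => by
      have : (c : ℂ) ≠ 0 := by exact_mod_cast hpos.ne'
      simp [Matrix.trace_smul, hc, this]⟩
    have h2 : Θ K = c • Θ (c⁻¹ • K) := by
      have : K = (c : ℂ) • (c⁻¹ • K) := by
        have : (c : ℂ) • (c⁻¹ • K) = c • (c⁻¹ • K) := rfl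
        rw [this, smul_smul, mul_inv_cancel₀ hpos.ne', one_smul]
      conv_lhs => rw [this, map_smul]
      rfl
    rw [h2]
    exact (hΘ.isSubchannel h).1.smul hpos.le

/-- A linear map that is constant on states is a replacer. -/
lemma eq_replacer_of_const [DecidableEq M] {L : LMap M M'} (m₀ : M)
    (h : ∀ ρ ω : Op M, IsState ρ → IsState ω → L ρ = L ω) :
    L = replacer M (L (Matrix.single m₀ m₀ 1)) := by
  have hs : ∀ m : M, IsState (Matrix.single m m (1 : ℂ)) := fun m =>
    ⟨posSemidef_single m, by simp⟩
  refine choi_injective ?_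
  ext ⟨i, b⟩ ⟨j, b'⟩
  rw [choi_replacer]
  rcases eq_or_ne i j with rfl | hij
  · simp [choi, Matrix.kroneckerMap_apply, h _ _ (hs i) (hs m₀)]
  · have hstate : ∀ z : ℂ, z * star z = 1 →
        IsState ((1 / 2 : ℝ) • Matrix.vecMulVec (Pi.single i 1 + Pi.single j z : M → ℂ)
          (star (Pi.single i 1 + Pi.single j z : M → ℂ))) := by
      intro z hz
      refine ⟨posSemidef_real_smul (posSemidef_vecMulVec _) (by norm_num), ?_⟩
      rw [Matrix.trace_smul, Matrix.trace_vecMulVec]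
      simp only [dotProduct, Pi.add_apply, Pi.star_apply, Pi.single_apply, star_add,
        apply_ite star, star_one, star_zero]
      rw [show (∑ k, ((if k = i then (1 : ℂ) else 0) + if k = j then z else 0) *
          ((if k = i then (1 : ℂ) else 0) + if k = j then star z else 0)) =
          ∑ k, ((if k = i then (1 : ℂ) else 0) + if k = j then z * star z else 0) from
        Finset.sum_congr rfl fun k _ => by
          by_cases h1 : k = i
          · have : ¬ k = j := fun h2 => hij (h1.symm.trans h2)
            simp [h1, hij]
          · by_cases h2 : k = j
            · simp [h2, hij.symm]
            · simp [h1, h2]]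
      rw [hz, Finset.sum_add_distrib]
      simp
      norm_num
    -- Polarization into states. The coefficients `1`, `I` and twice `-(1 + I) / 2` sum to zero, so
    -- a map constant on states annihilates the off-diagonal matrix units.
    have hexp : Matrix.single i j (1 : ℂ) =
        (1 / 2 : ℝ) • Matrix.vecMulVec (Pi.single i 1 + Pi.single j 1 : M → ℂ)
          (star (Pi.single i 1 + Pi.single j 1 : M → ℂ)) +
        Complex.I • ((1 / 2 : ℝ) • Matrix.vecMulVec
          (Pi.single i 1 + Pi.single j Complex.I : M → ℂ)
          (star (Pi.single i 1 + Pi.single j Complex.I : M → ℂ))) -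
        ((1 + Complex.I) / 2) • (Matrix.single i i 1 + Matrix.single j j 1) := by
      ext k l
      simp only [Matrix.sub_apply, Matrix.add_apply, Matrix.smul_apply, Matrix.vecMulVec_apply,
        Pi.add_apply, Pi.star_apply, star_add, Pi.single_apply, Matrix.single_apply,
        Complex.real_smul, smul_eq_mul, apply_ite star, star_one, star_zero, Complex.star_def,
        Complex.conj_I]
      by_cases h1 : k = i <;> by_cases h2 : k = j <;> by_cases h3 : l = i <;>
        by_cases h4 : l = j <;> simp_all [eq_comm] <;> ring_nf <;> simp <;> ring_nf
    have h0 : L (Matrix.single i j 1) = 0 := by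
      rw [hexp, map_sub, map_add, map_smul L Complex.I, map_smul L ((1 + Complex.I) / 2), map_add,
        h _ _ (hstate 1 (by simp)) (hs m₀), h _ _ (hstate Complex.I (by simp)) (hs m₀),
        h _ _ (hs i) (hs m₀), h _ _ (hs j) (hs m₀)]
      module
    simp [choi, Matrix.kroneckerMap_apply, h0, Matrix.one_apply_ne hij]

lemma isChannel_replacer {σ : Op B} (hσ : IsState σ) : IsChannel (replacer A σ) := by
  classical
  refine ⟨?_, fun X => by simp [Matrix.trace_smul, hσ.2]⟩
  rw [isCP_iff_choi, choi_replacer]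
  exact posSemidef_kronecker Matrix.PosSemidef.one hσ.1

lemma IsPNA.exists_eq_replacer [DecidableEq B] [DecidableEq M] [Nonempty M]
    {Θ : Supermap A B M M'} (hΘ : IsPNA Θ) {σ : Op B} (hσ : IsState σ) :
    ∃ τ : Op M', τ.PosSemidef ∧ Θ (replacer A σ) = replacer M τ := by
  obtain ⟨hprob, Ξ, D, ⟨-, hΞ⟩, -, hΘΞ⟩ := hΘ
  obtain ⟨m₀⟩ := ‹Nonempty M›
  refine ⟨_, (hprob.isSubchannel (isChannel_replacer hσ)).1.posSemidef (posSemidef_single m₀),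
    eq_replacer_of_const m₀ fun ρ ω hρ hω => ?_⟩
  have h := hΞ ρ ω σ hρ hω hσ
  rw [traceFst_bipartite, traceFst_bipartite] at h
  rw [hΘΞ, hΘΞ, h]

/-- A nonsignalling-assisted protocol maps a channel comparable to a replacer to a map comparable to
a replacer. -/
lemma IsPNA.exists_isComparable [DecidableEq A] [DecidableEq B] [DecidableEq M] [Nonempty M]
    {Θ : Supermap A B M M'} (hΘ : IsPNA Θ) {N : LMap A B} (hN : IsChannel N) {σ : Op B}
    (hσ : IsState σ) {k l : ℝ} (h : IsComparable N σ k l) :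
    ∃ τ : Op M', τ.PosSemidef ∧ IsCP (k • replacer M τ - Θ N) ∧
      IsCP (l • Θ N - replacer M τ) := by
  obtain ⟨τ, hτ, hΘτ⟩ := hΘ.exists_eq_replacer hσ
  have hsmul : ∀ (c : ℝ) (K : LMap A B), Θ (c • K) = c • Θ K := fun c K =>
    map_smul Θ (c : ℂ) K
  refine ⟨τ, hτ, ?_, ?_⟩
  · have := hΘ.1.isCP h.left (c := k - 1) fun X => by
      simp [hN.2, Matrix.trace_smul, hσ.2, sub_mul]
    rwa [map_sub, hsmul, hΘτ] at this
  · have := hΘ.1.isCP h.right (c := l - 1) fun X => by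
      simp [hN.2, Matrix.trace_smul, hσ.2, sub_mul]
    rwa [map_sub, hsmul, hΘτ] at this

/-- Here `p` and `t` are the weights of the correct and of any conclusive outcome, and `τ` and `T`
are the corresponding weights of the replacer. -/
lemma ratio_bound {ε p t T τ k l : ℝ} (hε : ε < 1) (hl : 0 < l) (ht : 0 ≤ t)
    (hr : 1 - ε ≤ p / t) (hp : p ≤ k * τ) (hT : T ≤ l * t) :
    0 < k * τ ∧ (1 - ε) * T ≤ k * l * τ := by
  have ht' : 0 < t := by
    -- A never conclusive input has ratio `0`, which is incompatible with `ε < 1`.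
    rcases ht.lt_or_eq with h | rfl
    · exact h
    · rw [div_zero] at hr
      linarith
  rw [le_div_iff₀ ht'] at hr
  have : 0 < (1 - ε) * t := by
    have : 0 < 1 - ε := by linarith
    positivity
  refine ⟨by linarith, ?_⟩
  calc (1 - ε) * T ≤ (1 - ε) * (l * t) := by gcongr
    _ = l * ((1 - ε) * t) := by ring
    _ ≤ l * (k * τ) := by
      exact mul_le_mul_of_nonneg_left (hr.trans hp) hl.le
    _ = k * l * τ := by ring

/-- Each message gives `(1 - ε) Tr τ ≤ k l τ_mm`. In the sum over `m` the right-hand diagonal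
entries add up to `Tr τ`, which is positive and cancels. -/
lemma le_of_errC_le [DecidableEq A] [DecidableEq B] {d : ℕ} (hd : 1 ≤ d)
    {Θ : Supermap A B (Fin d) (Fin d)} (hΘ : IsPNA Θ) {N : LMap A B} (hN : IsChannel N)
    {σ : Op B} (hσ : IsState σ) {k l : ℝ} (hk : 0 < k) (hl : 0 < l) (h : IsComparable N σ k l)
    {ε : ℝ} (hε : ε < 1) (herr : errC Θ N ≤ ε) : d * (1 - ε) ≤ k * l := by
  have : Nonempty (Fin d) := ⟨⟨0, hd⟩⟩
  obtain ⟨τ, hτ, h1, h2⟩ := hΘ.exists_isComparable hN hσ h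
  have key : ∀ m : Fin d, 0 < k * (τ m m).re ∧ (1 - ε) * τ.trace.re ≤ k * l * (τ m m).re := by
    intro m
    have e1 := (Complex.le_def.1 ((h1.posSemidef (posSemidef_single m)).diag_nonneg (i := m))).1
    have e2 := re_trace_nonneg (h2.posSemidef (posSemidef_single m))
    have e3 := re_trace_nonneg ((hΘ.1.isSubchannel hN).1.posSemidef (posSemidef_single m))
    simp [Matrix.trace_smul] at e1 e2
    refine ratio_bound hε hl e3 ?_ e1 e2
    rw [errC] at herr
    have := ciInf_le (Set.finite_range fun m : Fin d => (Θ N (Matrix.single m m 1) m m).re /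
      (Θ N (Matrix.single m m 1)).trace.re).bddBelow m
    linarith
  have hT : τ.trace.re = ∑ m, (τ m m).re := by simp [Matrix.trace]
  have hpos : 0 < τ.trace.re := by
    rw [hT]
    exact Finset.sum_pos (fun m _ => pos_of_mul_pos_right (key m).1 hk.le) Finset.univ_nonempty
  have hsum := Finset.sum_le_sum fun m (_ : m ∈ Finset.univ) => (key m).2
  rw [← Finset.mul_sum (a := k * l), ← hT, Finset.sum_const, Finset.card_univ, Fintype.card_fin,
    nsmul_eq_mul, ← mul_assoc] at hsum
  exact le_of_mul_le_mul_right hsum hpos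

lemma re_trace_vecMulVec_mul_nonneg {v : M → ℂ} {P : Op M} (hP : P.PosSemidef) :
    0 ≤ (Matrix.vecMulVec v (star v) * P).trace.re := by
  rw [Matrix.trace_mul_comm, Matrix.mul_vecMulVec, Matrix.trace_vecMulVec, dotProduct_comm]
  exact (Complex.le_def.1 (hP.dotProduct_mulVec_nonneg v)).1

lemma le_of_errQ_le [DecidableEq A] [DecidableEq B] {d : ℕ} (hd : 1 ≤ d)
    {Θ : Supermap A B (Fin d) (Fin d)} (hΘ : IsPNA Θ) {N : LMap A B} (hN : IsChannel N)
    {σ : Op B} (hσ : IsState σ) {k l : ℝ} (hk : 0 < k) (hl : 0 < l) (h : IsComparable N σ k l)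
    {ε : ℝ} (hε : ε < 1) (herr : errQ Θ N ≤ ε) : (d : ℝ) ^ 2 * (1 - ε) ≤ k * l := by
  have : Nonempty (Fin d) := ⟨⟨0, hd⟩⟩
  have hd0 : (0 : ℝ) < d := by exact_mod_cast hd
  obtain ⟨τ, hτ, h1, h2⟩ := hΘ.exists_isComparable hN hσ h
  set Φ : Op (Fin d × Fin d) := maxEnt (Equiv.refl _) with hΦ
  have hΦs : IsState Φ := isState_maxEnt _
  have e1 := re_trace_vecMulVec_mul_nonneg (v := maxEntVec (Equiv.refl (Fin d)))
    (h1.posSemidef_idTensor hΦs.1)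
  have e2 := re_trace_nonneg (h2.posSemidef_idTensor hΦs.1)
  have e3 := re_trace_nonneg ((hΘ.1.isSubchannel hN).1.posSemidef_idTensor hΦs.1)
  have s1 : idTensor (Fin d) (k • replacer (Fin d) τ - Θ N) Φ =
      k • (traceSnd Φ ⊗ₖ τ) - idTensor (Fin d) (Θ N) Φ := by
    rw [← idTensor_replacer]
    rfl
  have s2 : idTensor (Fin d) (l • Θ N - replacer (Fin d) τ) Φ =
      l • idTensor (Fin d) (Θ N) Φ - traceSnd Φ ⊗ₖ τ := by
    rw [← idTensor_replacer]
    rfl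
  -- The marginal of `Φ` is `1 / d`, and `Φ` overlaps with `1 ⊗ τ` by `Tr τ / d`. The two factors
  -- produce the `d²` of the quantum bound.
  have s3 : (Φ * (traceSnd Φ ⊗ₖ τ)).trace = (d : ℂ)⁻¹ ^ 2 * τ.trace := by
    rw [hΦ, traceSnd_maxEnt]
    simp [Matrix.trace, Matrix.mul_apply, maxEnt_apply, Fintype.sum_prod_type,
      Matrix.kroneckerMap_apply, Matrix.one_apply, Finset.mul_sum]
    exact Finset.sum_congr rfl fun x _ => by ring
  rw [s1] at e1
  rw [s2] at e2
  change 0 ≤ (Φ * _).trace.re at e1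
  rw [Matrix.mul_sub, Matrix.mul_smul, Matrix.trace_sub, Matrix.trace_smul, s3] at e1
  rw [Matrix.trace_sub, Matrix.trace_smul, Matrix.trace_kronecker, trace_traceSnd, hΦs.2] at e2
  have s4 : ((d : ℂ)⁻¹ ^ 2 * τ.trace).re = (d : ℝ)⁻¹ ^ 2 * τ.trace.re := by
    have : (d : ℂ)⁻¹ ^ 2 = (((d : ℝ)⁻¹ ^ 2 : ℝ) : ℂ) := by simp
    rw [this, Complex.re_ofReal_mul]
  simp only [Complex.sub_re, Complex.real_smul, Complex.re_ofReal_mul, one_mul, s4] at e1 e2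
  have hr : 1 - ε ≤ (Φ * idTensor (Fin d) (Θ N) Φ).trace.re /
      (idTensor (Fin d) (Θ N) Φ).trace.re := by
    rw [errQ] at herr
    have hmem : (Φ * idTensor (Fin d) (Θ N) Φ).trace.re / (idTensor (Fin d) (Θ N) Φ).trace.re ∈
        {x : ℝ | ∃ (r : ℕ) (v : Fin r × Fin d → ℂ), ∑ i, ‖v i‖ ^ 2 = 1 ∧
          x = (Matrix.vecMulVec v (star v) *
            idTensor (Fin r) (Θ N) (Matrix.vecMulVec v (star v))).trace.re /
          (idTensor (Fin r) (Θ N) (Matrix.vecMulVec v (star v))).trace.re} :=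
      ⟨d, maxEntVec (Equiv.refl (Fin d)), sum_norm_maxEntVec _, rfl⟩
    -- Were the set of ratios unbounded below, its real infimum would be `0` by convention and the
    -- error `1`, exceeding `ε`.
    refine le_trans ?_ (csInf_le (not_imp_comm.1 Real.sInf_of_not_bddBelow fun h0 => ?_) hmem)
    · linarith
    · rw [h0] at herr
      linarith
  obtain ⟨hpos, hle⟩ := ratio_bound hε hl e3 hr (sub_nonneg.1 e1) (sub_nonneg.1 e2)
  have hpos' : 0 < τ.trace.re := pos_of_mul_pos_right (pos_of_mul_pos_right hpos hk.le)
    (by positivity)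
  have : (1 - ε) ≤ k * l * (d : ℝ)⁻¹ ^ 2 := by
    refine le_of_mul_le_mul_right ?_ hpos'
    linarith
  calc (d : ℝ) ^ 2 * (1 - ε) ≤ (d : ℝ) ^ 2 * (k * l * (d : ℝ)⁻¹ ^ 2) := by gcongr
    _ = k * l := by field_simp

end Converse

/-! ### Projective mutual information and comparison with replacers -/

section MutualInformation

variable {A B R : Type*} [Fintype A] [Fintype B] [Fintype R]

lemma one_le_of_posSemidef_smul_sub {ρ σ : Op A} (hρ : ρ.trace = 1) (hσ : σ.trace = 1) {l : ℝ}
    (h : (l • σ - ρ).PosSemidef) : 1 ≤ l := by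
  have := re_trace_nonneg h
  rw [Matrix.trace_sub, Matrix.trace_smul, hρ, hσ] at this
  simpa using this

lemma Dmax_nonneg {ρ σ : Op A} (hρ : ρ.trace = 1) (hσ : σ.trace = 1) : 0 ≤ Dmax ρ σ :=
  le_iInf fun _ => le_iInf fun _ => le_iInf fun h => EReal.coe_nonneg.2 <|
    Real.logb_nonneg one_lt_two (one_le_of_posSemidef_smul_sub hρ hσ h)

lemma exists_of_DOmega_lt {ρ σ : Op A} (hρ : ρ.trace = 1) (hσ : σ.trace = 1) {x : ℝ}
    (h : DOmega ρ σ < x) : ∃ k l : ℝ, 0 < k ∧ 0 < l ∧ (k • σ - ρ).PosSemidef ∧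
      (l • ρ - σ).PosSemidef ∧ Real.logb 2 k + Real.logb 2 l < x := by
  by_contra! hc
  -- Unit traces make both max-relative entropies nonnegative, so `⊥` does not interfere with
  -- approximating the extended-real sum.
  refine h.not_ge (EReal.le_add_of_forall_gt (.inl ?_) (.inr ?_) fun a ha b hb => ?_)
  · exact (EReal.bot_lt_zero.trans_le (Dmax_nonneg hρ hσ)).ne'
  · exact (EReal.bot_lt_zero.trans_le (Dmax_nonneg hσ hρ)).ne'
  · simp only [Dmax, iInf_lt_iff] at ha hb
    obtain ⟨k, hk, hk', hka⟩ := ha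
    obtain ⟨l, hl, hl', hlb⟩ := hb
    refine le_trans ?_ (add_le_add hka.le hlb.le)
    rw [← EReal.coe_add]
    exact EReal.coe_le_coe_iff.2 (hc k l hk hl hk' hl')

lemma exists_isComparable_of_IOmega_lt [DecidableEq A] [Nonempty A] {N : LMap A B}
    (hN : IsChannel N) {x : ℝ} (h : IOmega N < x) :
    ∃ (σ : Op B) (k l : ℝ), IsState σ ∧ 0 < k ∧ 0 < l ∧ IsComparable N σ k l ∧
      Real.logb 2 k + Real.logb 2 l < x := by
  classical
  set e := (Fintype.equivFin A).symm
  have h0 : stateIOmega (idTensor (Fin (Fintype.card A)) N (maxEnt e)) ≤ IOmega N :=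
    le_iSup_of_le (Fintype.card A) (le_iSup_of_le (maxEnt e)
      (le_iSup_of_le (isState_maxEnt e) le_rfl))
  have h1 := h0.trans_lt h
  have he : ∀ p : A × B, Prod.map e id (Prod.map e.symm id p) = p := fun p => by
    simp [Prod.map]
  simp only [stateIOmega, iInf_lt_iff] at h1
  obtain ⟨σ, hσ, h1⟩ := h1
  have hcard : (0 : ℝ) < Fintype.card A := by exact_mod_cast Fintype.card_pos
  rw [traceSnd_idTensor hN.2, traceSnd_maxEnt] at h1
  obtain ⟨k, l, hk, hl, h2, h3, h4⟩ := exists_of_DOmega_lt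
    ((isChannel_idTensor hN).2 _ |>.trans (isState_maxEnt e).2) (by
      rw [Matrix.trace_kronecker, hσ.2, Matrix.trace_smul, Matrix.trace_one, Fintype.card_fin]
      simp) h1
  rw [idTensor_maxEnt] at h2 h3
  refine ⟨σ, k, l, hσ, hk, hl, isComparable_iff.2 ⟨?_, ?_⟩, h4⟩
  · convert posSemidef_real_smul (h2.submatrix (Prod.map e.symm id)) hcard.le using 1
    ext p q
    simp [Matrix.kroneckerMap_apply, Matrix.one_apply, Matrix.submatrix_apply, he]
    split_ifs <;> [field_simp; (field_simp; simp)]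
  · convert posSemidef_real_smul (h3.submatrix (Prod.map e.symm id)) hcard.le using 1
    ext p q
    simp [Matrix.kroneckerMap_apply, Matrix.one_apply, Matrix.submatrix_apply, he]
    split_ifs <;> [field_simp; (field_simp; simp)]

lemma IOmega_le [DecidableEq A] {N : LMap A B} (hN : IsChannel N) {σ : Op B}
    (hσ : IsState σ) {k l : ℝ} (hk : 0 < k) (hl : 0 < l) (h : IsComparable N σ k l) :
    IOmega N ≤ ((Real.logb 2 k + Real.logb 2 l : ℝ) : EReal) := by
  refine iSup_le fun r => iSup_le fun ρ => iSup_le fun hρ => ?_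
  refine iInf_le_of_le σ (iInf_le_of_le hσ ?_)
  rw [traceSnd_idTensor hN.2, EReal.coe_add]
  refine add_le_add (iInf_le_of_le k (iInf_le_of_le hk (iInf_le_of_le ?_ le_rfl)))
    (iInf_le_of_le l (iInf_le_of_le hl (iInf_le_of_le ?_ le_rfl)))
  · have := h.left.posSemidef_idTensor hρ.1
    rwa [show idTensor (Fin r) (k • replacer A σ - N) ρ =
      k • (traceSnd ρ ⊗ₖ σ) - idTensor (Fin r) N ρ by rw [← idTensor_replacer]; rfl] at this
  · have := h.right.posSemidef_idTensor hρ.1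
    rwa [show idTensor (Fin r) (l • N - replacer A σ) ρ =
      l • idTensor (Fin r) N ρ - traceSnd ρ ⊗ₖ σ by rw [← idTensor_replacer]; rfl] at this

lemma trace_choi [DecidableEq A] {N : LMap A B} (hN : IsChannel N) :
    (choi N).trace = Fintype.card A := by
  have h : (choi N).trace = ∑ a, (N (Matrix.single a a 1)).trace := by
    simp [Matrix.trace, Fintype.sum_prod_type, choi]
  rw [h]
  simp [hN.2]

/-- Absorbing the first factor into the scale of `P` leaves one constraint that is linear in `P`,
the form suited to duality. -/
lemma IOmega_le_of_sandwich [DecidableEq A] [Nonempty A] {N : LMap A B} (hN : IsChannel N)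
    {P : Op B} {k : ℝ} (h1 : ((1 : Op A) ⊗ₖ P - choi N).PosSemidef)
    (h2 : (k • choi N - (1 : Op A) ⊗ₖ P).PosSemidef) :
    IOmega N ≤ ((Real.logb 2 k : ℝ) : EReal) := by
  classical
  obtain ⟨a⟩ := ‹Nonempty A›
  have hcard : (0 : ℝ) < Fintype.card A := by exact_mod_cast Fintype.card_pos_iff.2 ⟨a⟩
  have hP : P.PosSemidef := by
    have h := (h1.add hN.1.posSemidef_choi).submatrix fun b : B => (a, b)
    convert h using 1
    ext b b'
    simp [Matrix.kroneckerMap_apply]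
  have ht1 := re_trace_nonneg h1
  have ht2 := re_trace_nonneg h2
  rw [Matrix.trace_sub, Matrix.trace_kronecker, Matrix.trace_one, trace_choi hN] at ht1
  rw [Matrix.trace_sub, Matrix.trace_kronecker, Matrix.trace_one, Matrix.trace_smul,
    trace_choi hN] at ht2
  simp at ht1 ht2
  set t := P.trace.re with ht
  have ht1' : 1 ≤ t := by
    by_contra! hlt
    nlinarith
  have htk : t ≤ k := le_of_mul_le_mul_left (by linarith) hcard
  have ht0 : 0 < t := by linarith
  have htP : P.trace = (t : ℂ) := by
    apply Complex.ext
    · simp [ht]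
    · simpa using (Complex.le_def.1 hP.trace_nonneg).2.symm
  -- With `P = t σ`, the two comparison factors are `t` and `k / t`, whose product is `k` whatever
  -- the trace `t` is.
  have hcomp : IsComparable N (t⁻¹ • P) t (k / t) := by
    rw [isComparable_iff]
    constructor
    · rwa [Matrix.kronecker_smul, smul_smul, mul_inv_cancel₀ ht0.ne', one_smul]
    · convert posSemidef_real_smul h2 (inv_nonneg.2 ht0.le) using 1
      rw [Matrix.kronecker_smul, smul_sub, smul_smul, div_eq_inv_mul]
  have hσ : IsState (t⁻¹ • P) := ⟨posSemidef_real_smul hP (inv_nonneg.2 ht0.le), by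
    rw [Matrix.trace_smul, htP, Complex.real_smul, ← Complex.ofReal_mul, inv_mul_cancel₀ ht0.ne',
      Complex.ofReal_one]⟩
  have := IOmega_le hN hσ ht0 (div_pos (by linarith) ht0) hcomp
  rwa [← Real.logb_mul ht0.ne' (div_pos (by linarith) ht0).ne', mul_div_cancel₀ _ ht0.ne'] at this

end MutualInformation

/-! ### Strong duality -/

section Duality

variable {A B ι : Type*} [Fintype A] [DecidableEq A] [Fintype B] [DecidableEq B] [Fintype ι]
  [DecidableEq ι]

/-- The bilinear pairing `Re Σ U i j * X i j`. -/
def pairing (X U : Op ι) : ℝ := (∑ i, ∑ j, U i j * X i j).re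

lemma pairing_add_left (X Y U : Op ι) : pairing (X + Y) U = pairing X U + pairing Y U := by
  simp [pairing, mul_add, Finset.sum_add_distrib]

lemma pairing_smul_left (c : ℝ) (X U : Op ι) : pairing (c • X) U = c * pairing X U := by
  have : ∀ i j, U i j * (c • X) i j = (c : ℂ) * (U i j * X i j) := fun i j => by
    rw [Matrix.smul_apply, Complex.real_smul]
    ring
  simp only [pairing, this, ← Finset.mul_sum, Complex.re_ofReal_mul]

lemma pairing_nonneg {X U : Op ι} (hX : X.PosSemidef) (hU : U.PosSemidef) : 0 ≤ pairing X U := by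
  have h := (posSemidef_sum_snd (ι := Unit) ((posSemidef_hadamard hU hX).submatrix
    Prod.snd)).diag_nonneg (i := ())
  exact (Complex.le_def.1 h).1

lemma pairing_vecMulVec (X : Op ι) (v : ι → ℂ) :
    pairing X (Matrix.vecMulVec (star v) v) = (star v ⬝ᵥ X *ᵥ v).re := by
  rw [pairing]
  congr 1
  simp only [dotProduct, Matrix.mulVec, Finset.mul_sum, Matrix.vecMulVec_apply]
  exact Finset.sum_congr rfl fun i _ => Finset.sum_congr rfl fun j _ => by ring

/-- A real functional on Hermitian matrices that is nonnegative on positive semidefinite matrices is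
given by pairing with a positive semidefinite matrix. -/
lemma exists_pairing_eq (φ : Op ι →ₗ[ℝ] ℝ) (hφ : ∀ U : Op ι, U.PosSemidef → 0 ≤ φ U) :
    ∃ X : Op ι, X.PosSemidef ∧ ∀ U : Op ι, U.IsHermitian → φ U = pairing X U := by
  -- A real-linear functional is determined by its values on the matrix units and on their multiples
  -- by `I`.
  set Z : Op ι := Matrix.of fun i j =>
    (φ (Matrix.single i j 1) : ℂ) - Complex.I * φ (Matrix.single i j Complex.I) with hZ
  have h1 : ∀ U : Op ι, φ U = pairing Z U := by
    intro U
    conv_lhs => rw [Matrix.matrix_eq_sum_single U]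
    simp only [map_sum, pairing, Complex.re_sum]
    refine Finset.sum_congr rfl fun i _ => Finset.sum_congr rfl fun j _ => ?_
    have : Matrix.single i j (U i j) = (U i j).re • Matrix.single i j (1 : ℂ) +
        (U i j).im • Matrix.single i j Complex.I := by
      rw [Matrix.smul_single, Matrix.smul_single, ← Matrix.single_add]
      congr 1
      simp
    rw [this, map_add, map_smul, map_smul]
    simp [hZ]
  have h2 : ∀ U : Op ι, U.IsHermitian → pairing Zᴴ U = pairing Z U := by
    intro U hU
    have : (∑ i, ∑ j, U i j * Zᴴ i j) = star (∑ i, ∑ j, U i j * Z i j) := by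
      rw [star_sum, Finset.sum_comm]
      refine Finset.sum_congr rfl fun i _ => ?_
      rw [star_sum]
      refine Finset.sum_congr rfl fun j _ => ?_
      rw [star_mul', Matrix.conjTranspose_apply, hU.apply]
    rw [pairing, this, pairing]
    simp
  -- Passing to the Hermitian part does not change the pairing with Hermitian matrices.
  set X : Op ι := (1 / 2 : ℝ) • (Z + Zᴴ) with hX
  have h3 : ∀ U : Op ι, U.IsHermitian → φ U = pairing X U := by
    intro U hU
    rw [hX, pairing_smul_left, pairing_add_left, h2 U hU, h1]
    ring
  have hXh : X.IsHermitian := by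
    rw [hX]
    refine Matrix.IsHermitian.ext fun i j => ?_
    simp [add_comm]
  refine ⟨X, Matrix.PosSemidef.of_dotProduct_mulVec_nonneg hXh fun v => ?_, h3⟩
  have hv : (Matrix.vecMulVec (star v) v).PosSemidef := by
    simpa using posSemidef_vecMulVec (star v)
  rw [Complex.le_def]
  refine ⟨?_, ?_⟩
  · rw [Complex.zero_re, ← pairing_vecMulVec, ← h3 _ hv.isHermitian]
    exact hφ _ hv
  · exact (hXh.im_star_dotProduct_mulVec_self v).symm

end Duality

/-! ### Hahn–Banach separation for the sandwich problem. -/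

section Separation

variable {A B ι : Type*} [Fintype A] [DecidableEq A] [Fintype B] [DecidableEq B] [Fintype ι]
  [DecidableEq ι]

lemma posSemidef_iff_re {U : Op ι} :
    U.PosSemidef ↔ U.IsHermitian ∧ ∀ v : ι → ℂ, 0 ≤ (star v ⬝ᵥ U *ᵥ v).re := by
  refine ⟨fun h => ⟨h.isHermitian, fun v => (Complex.le_def.1 (h.dotProduct_mulVec_nonneg v)).1⟩,
    fun ⟨h1, h2⟩ => Matrix.PosSemidef.of_dotProduct_mulVec_nonneg h1 fun v => ?_⟩
  rw [Complex.le_def]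
  exact ⟨h2 v, (h1.im_star_dotProduct_mulVec_self v).symm⟩

lemma isClosed_isHermitian : IsClosed {U : Op ι | U.IsHermitian} :=
  isClosed_eq continuous_id.matrix_conjTranspose continuous_id

lemma isClosed_posSemidef : IsClosed {U : Op ι | U.PosSemidef} := by
  simp only [posSemidef_iff_re, Set.ofPred_and, Set.ofPred_forall]
  refine isClosed_isHermitian.inter (isClosed_iInter fun v => isClosed_le continuous_const ?_)
  exact Complex.continuous_re.comp
    (continuous_const.dotProduct (continuous_id.matrix_mulVec continuous_const))

/-- Hermitian matrices with entries bounded by `c`. -/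
def boundedHermitian (ι : Type*) (c : ℝ) : Set (Op ι) :=
  {P | P.IsHermitian ∧ ∀ i j, ‖P i j‖ ≤ c}

lemma isCompact_boundedHermitian (c : ℝ) : IsCompact (boundedHermitian ι c) := by
  have h : IsCompact (Set.pi Set.univ fun _ : ι => Set.pi Set.univ fun _ : ι =>
      Metric.closedBall (0 : ℂ) c) :=
    isCompact_univ_pi fun _ => isCompact_univ_pi fun _ => isCompact_closedBall 0 c
  have h' : (Set.pi Set.univ fun _ : ι => Set.pi Set.univ fun _ : ι =>
      Metric.closedBall (0 : ℂ) c) = {P : ι → ι → ℂ | ∀ i j, ‖P i j‖ ≤ c} := by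
    ext P
    simp
  rw [h'] at h
  exact IsCompact.inter_left (X := Op ι) h isClosed_isHermitian

lemma convex_boundedHermitian (c : ℝ) : Convex ℝ (boundedHermitian ι c) := by
  rintro P ⟨hP, hP'⟩ Q ⟨hQ, hQ'⟩ a b ha hb hab
  refine ⟨(hP.smul (by simp [IsSelfAdjoint])).add (hQ.smul (by simp [IsSelfAdjoint])),
    fun i j => ?_⟩
  calc ‖(a • P + b • Q) i j‖ ≤ ‖a • P i j‖ + ‖b • Q i j‖ := norm_add_le _ _
    _ = a * ‖P i j‖ + b * ‖Q i j‖ := by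
      rw [norm_smul, norm_smul, Real.norm_of_nonneg ha, Real.norm_of_nonneg hb]
    _ ≤ a * c + b * c := by gcongr <;> solve_by_elim
    _ = c := by rw [← add_mul, hab, one_mul]

lemma convex_posSemidef : Convex ℝ {U : Op ι | U.PosSemidef} :=
  fun _ hU _ hV _ _ ha hb _ => (posSemidef_real_smul hU ha).add (posSemidef_real_smul hV hb)

lemma isHermitian_one_kronecker {P : Op B} (hP : P.IsHermitian) :
    ((1 : Op A) ⊗ₖ P).IsHermitian := by
  rw [Matrix.IsHermitian, Matrix.conjTranspose_kronecker, Matrix.conjTranspose_one, hP]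

lemma pairing_one_kronecker (X : Op (A × B)) (P : Op B) :
    pairing X ((1 : Op A) ⊗ₖ P) = pairing (traceFst X) P := by
  rw [pairing, pairing]
  congr 1
  simp only [Fintype.sum_prod_type, Matrix.kroneckerMap_apply, traceFst, Matrix.of_apply,
    Finset.mul_sum, Matrix.one_apply, ite_mul, one_mul, zero_mul]
  rw [Finset.sum_comm]
  refine Finset.sum_congr rfl fun b _ => ?_
  rw [Finset.sum_comm (s := Finset.univ (α := B))]
  refine Finset.sum_congr rfl fun a _ => ?_
  rw [Finset.sum_comm]
  simp

lemma pairing_sub_right (X U V : Op ι) : pairing X (U - V) = pairing X U - pairing X V := by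
  simp [pairing, sub_mul, Finset.sum_sub_distrib]

lemma pairing_smul_right (c : ℝ) (X U : Op ι) : pairing X (c • U) = c * pairing X U := by
  have : ∀ i j, (c • U) i j * X i j = (c : ℂ) * (U i j * X i j) := fun i j => by
    rw [Matrix.smul_apply, Complex.real_smul]
    ring
  simp only [pairing, this, ← Finset.mul_sum, Complex.re_ofReal_mul]

lemma pairing_one_left (U : Op ι) : pairing 1 U = U.trace.re := by
  simp [pairing, Matrix.one_apply, Matrix.trace]

/-- The affine image of a bounded set of candidates `P` is compact and misses the closed cone of
pairs of positive semidefinite matrices. Bounding `P` secures strict separation; the resulting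
marginals need not agree yet. -/
lemma exists_separating {J : Op (A × B)} (hJ : J.IsHermitian) {k : ℝ}
    (hinf : ∀ P : Op B, ¬(((1 : Op A) ⊗ₖ P - J).PosSemidef ∧
      (k • J - (1 : Op A) ⊗ₖ P).PosSemidef)) (c : ℝ) :
    ∃ X Y : Op (A × B), X.PosSemidef ∧ Y.PosSemidef ∧ ∀ P ∈ boundedHermitian B c,
      pairing (traceFst X) P - pairing (traceFst Y) P < pairing X J - k * pairing Y J := by
  have : LocallyConvexSpace ℝ (Op (A × B)) :=
    inferInstanceAs (LocallyConvexSpace ℝ (A × B → A × B → ℂ))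
  set F : Op B → Op (A × B) × Op (A × B) :=
    fun P => ((1 : Op A) ⊗ₖ P - J, k • J - (1 : Op A) ⊗ₖ P) with hF
  have hkr : Continuous fun P : Op B => (1 : Op A) ⊗ₖ P := by
    refine continuous_matrix fun p q => ?_
    simp only [Matrix.kroneckerMap_apply]
    exact continuous_const.mul (continuous_id.matrix_elem _ _)
  have hFc : Continuous F :=
    (hkr.sub continuous_const).prodMk (continuous_const.sub hkr)
  have hconv : Convex ℝ (F '' boundedHermitian B c) := by
    rintro _ ⟨P, hP, rfl⟩ _ ⟨Q, hQ, rfl⟩ a b ha hb hab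
    refine ⟨a • P + b • Q, convex_boundedHermitian c hP hQ ha hb hab, ?_⟩
    have hJ' : J = a • J + b • J := by rw [← add_smul, hab, one_smul]
    simp only [hF, Prod.smul_mk, Prod.mk_add_mk, Matrix.kronecker_add, Matrix.kronecker_smul]
    refine Prod.ext ?_ ?_
    · conv_lhs => rw [hJ']
      simp only [smul_sub]
      abel
    · conv_lhs => rw [hJ']
      simp only [smul_sub, smul_add, smul_comm k]
      abel
  obtain ⟨f, u, v, h1, huv, h2⟩ := geometric_hahn_banach_compact_closed hconv
    ((isCompact_boundedHermitian c).image hFc)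
    (convex_posSemidef.prod convex_posSemidef)
    (isClosed_posSemidef.prod isClosed_posSemidef)
    (by
      rw [Set.disjoint_left]
      rintro _ ⟨P, hP, rfl⟩ ⟨hA, hB⟩
      exact hinf P ⟨hA, hB⟩)
  have hv : v < 0 := by
    simpa using h2 0 ⟨Matrix.PosSemidef.zero, Matrix.PosSemidef.zero⟩
  -- A negative value could be scaled to equal `v`, contradicting the strict bound on the cone.
  have hpos : ∀ W : Op (A × B) × Op (A × B), W.1.PosSemidef → W.2.PosSemidef → 0 ≤ f W := by
    intro W hW1 hW2
    by_contra! hneg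
    have := h2 ((v / f W) • W) ⟨posSemidef_real_smul hW1 (div_pos_of_neg_of_neg hv hneg).le,
      posSemidef_real_smul hW2 (div_pos_of_neg_of_neg hv hneg).le⟩
    rw [map_smul, smul_eq_mul, div_mul_cancel₀ _ hneg.ne] at this
    exact lt_irrefl _ this
  obtain ⟨X, hX, hX'⟩ := exists_pairing_eq (f.toLinearMap ∘ₗ LinearMap.inl ℝ _ _)
    fun U hU => hpos (U, 0) hU Matrix.PosSemidef.zero
  obtain ⟨Y, hY, hY'⟩ := exists_pairing_eq (f.toLinearMap ∘ₗ LinearMap.inr ℝ _ _)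
    fun U hU => hpos (0, U) Matrix.PosSemidef.zero hU
  refine ⟨X, Y, hX, hY, fun P hP => ?_⟩
  have h3 : f (F P) < 0 := (h1 _ ⟨P, hP, rfl⟩).trans (huv.trans hv)
  have h4 : f (F P) = pairing X ((1 : Op A) ⊗ₖ P - J) + pairing Y (k • J - (1 : Op A) ⊗ₖ P) := by
    rw [← hX' _ ((isHermitian_one_kronecker hP.1).sub hJ),
      ← hY' _ ((hJ.smul (by simp [IsSelfAdjoint])).sub (isHermitian_one_kronecker hP.1))]
    simp only [LinearMap.comp_apply, LinearMap.inl_apply, LinearMap.inr_apply]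
    change _ = f _ + f _
    rw [← map_add]
    simp [hF]
  rw [h4, pairing_sub_right, pairing_sub_right, pairing_smul_right, pairing_one_kronecker,
    pairing_one_kronecker] at h3
  linarith

lemma traceFst_add (X Y : Op (A × B)) : traceFst (X + Y) = traceFst X + traceFst Y := by
  ext b b'
  simp [traceFst, Finset.sum_add_distrib]

lemma traceFst_one_kronecker (P : Op B) :
    traceFst ((1 : Op A) ⊗ₖ P) = (Fintype.card A : ℝ) • P := by
  ext b b'
  simp [traceFst, Matrix.kroneckerMap_apply]

lemma traceFst_smul (c : ℝ) (X : Op (A × B)) : traceFst (c • X) = c • traceFst X := by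
  ext b b'
  simp [traceFst, Finset.mul_sum]

lemma smul_vecMulVec_mem_boundedHermitian (v : ι → ℂ) {c : ℝ} (hc : 0 ≤ c) :
    (c / ∑ i, ‖v i‖ ^ 2) • Matrix.vecMulVec (star v) v ∈ boundedHermitian ι c := by
  have hs : 0 ≤ ∑ i, ‖v i‖ ^ 2 := Finset.sum_nonneg fun i _ => sq_nonneg _
  refine ⟨?_, fun i j => ?_⟩
  · have := (posSemidef_real_smul (posSemidef_vecMulVec (star v)) (div_nonneg hc hs)).isHermitian
    rwa [star_star] at this
  · rw [Matrix.smul_apply, norm_smul, Real.norm_of_nonneg (div_nonneg hc hs),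
      Matrix.vecMulVec_apply, norm_mul, Pi.star_apply, norm_star, div_mul_eq_mul_div]
    refine div_le_of_le_mul₀ hs hc (mul_le_mul_of_nonneg_left ?_ hc)
    have hi := Finset.single_le_sum (f := fun i => ‖v i‖ ^ 2) (fun i _ => sq_nonneg _)
      (Finset.mem_univ i)
    have hj := Finset.single_le_sum (f := fun i => ‖v i‖ ^ 2) (fun i _ => sq_nonneg _)
      (Finset.mem_univ j)
    nlinarith [two_mul_le_add_sq ‖v i‖ ‖v j‖]

lemma star_dotProduct_self (v : ι → ℂ) : (star v ⬝ᵥ v).re = ∑ i, ‖v i‖ ^ 2 := by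
  simp only [dotProduct, Pi.star_apply, Complex.re_sum]
  refine Finset.sum_congr rfl fun i _ => ?_
  rw [Complex.star_def, mul_comm, Complex.mul_conj, Complex.ofReal_re, Complex.normSq_eq_norm_sq]

/-- Strong duality for the sandwich `J ≤ 1 ⊗ P ≤ k J`. -/
lemma exists_dual_witness [Nonempty A] {J : Op (A × B)} (hJ : J.PosSemidef)
    (htr : J.trace = Fintype.card A) {k : ℝ}
    (hinf : ∀ P : Op B, ¬(((1 : Op A) ⊗ₖ P - J).PosSemidef ∧
      (k • J - (1 : Op A) ⊗ₖ P).PosSemidef)) :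
    ∃ X Y : Op (A × B), X.PosSemidef ∧ Y.PosSemidef ∧ traceFst X = traceFst Y ∧
      (traceFst Y).PosDef ∧ k * pairing Y J < pairing X J := by
  have hcard : (0 : ℝ) < Fintype.card A := by exact_mod_cast Fintype.card_pos
  -- The box must be larger than `k`: repairing the marginals below costs `k t = k g / c`, which
  -- must stay below the gap `g`.
  set c : ℝ := |k| + 1 with hc
  have hc0 : 0 < c := by positivity
  have hck : k < c := (le_abs_self k).trans_lt (lt_add_one _)
  obtain ⟨X, Y, hX, hY, hXY⟩ := exists_separating hJ.isHermitian hinf c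
  set g := pairing X J - k * pairing Y J with hg
  have hg0 : 0 < g := by
    have h0 := hXY 0 ⟨Matrix.isHermitian_zero, fun i j => by simp [hc0.le]⟩
    simpa [pairing] using h0
  set t := g / c with ht
  have ht0 : 0 < t := div_pos hg0 hc0
  -- Adding `1 ⊗ Δ / |A|` to `X` and `t (1 ⊗ 1) / |A|` to `Y` equalizes the marginals and makes them
  -- positive definite.
  set Δ : Op B := t • 1 + traceFst Y - traceFst X with hΔ
  have hherm : (t • (1 : Op B)).IsHermitian := Matrix.isHermitian_one.smul (by simp [IsSelfAdjoint])
  have hΔ0 : Δ.PosSemidef := by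
    rw [posSemidef_iff_re]
    refine ⟨(hherm.add (traceFst_posSemidef hY).isHermitian).sub
      (traceFst_posSemidef hX).isHermitian, fun v => ?_⟩
    rcases eq_or_ne v 0 with rfl | hv
    · simp
    have hs : 0 < ∑ i, ‖v i‖ ^ 2 := by
      obtain ⟨i, hi⟩ := Function.ne_iff.1 hv
      exact Finset.sum_pos' (fun i _ => sq_nonneg _) ⟨i, Finset.mem_univ i, by
        have : 0 < ‖v i‖ := norm_pos_iff.2 hi
        positivity⟩
    -- Testing `P = c |v⟩⟨v| / ‖v‖²`, up to conjugation, bounds the difference of the marginals of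
    -- `X` and `Y` by `g / c = t`.
    have h := hXY _ (smul_vecMulVec_mem_boundedHermitian v hc0.le)
    rw [pairing_smul_right, pairing_smul_right, pairing_vecMulVec, pairing_vecMulVec, ← mul_sub,
      div_mul_eq_mul_div, div_lt_iff₀ hs] at h
    have e1 : (star v ⬝ᵥ Δ *ᵥ v).re = t * (∑ i, ‖v i‖ ^ 2) +
        (star v ⬝ᵥ traceFst Y *ᵥ v).re - (star v ⬝ᵥ traceFst X *ᵥ v).re := by
      rw [hΔ, Matrix.sub_mulVec, Matrix.add_mulVec, Matrix.smul_mulVec, Matrix.one_mulVec,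
        dotProduct_sub, dotProduct_add, dotProduct_smul, Complex.sub_re, Complex.add_re,
        Complex.real_smul, Complex.re_ofReal_mul, star_dotProduct_self]
    have e2 : t * (∑ i, ‖v i‖ ^ 2) = g * (∑ i, ‖v i‖ ^ 2) / c := by
      rw [ht]
      ring
    rw [e1, e2]
    have e3 : (star v ⬝ᵥ traceFst X *ᵥ v).re - (star v ⬝ᵥ traceFst Y *ᵥ v).re ≤
        g * (∑ i, ‖v i‖ ^ 2) / c := by
      rw [le_div_iff₀ hc0]
      linarith
    linarith
  refine ⟨X + (Fintype.card A : ℝ)⁻¹ • ((1 : Op A) ⊗ₖ Δ),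
    Y + (Fintype.card A : ℝ)⁻¹ • ((1 : Op A) ⊗ₖ (t • (1 : Op B))), ?_, ?_, ?_, ?_, ?_⟩
  · exact hX.add (posSemidef_real_smul (posSemidef_kronecker Matrix.PosSemidef.one hΔ0)
      (inv_nonneg.2 hcard.le))
  · exact hY.add (posSemidef_real_smul (posSemidef_kronecker Matrix.PosSemidef.one
      (posSemidef_real_smul Matrix.PosSemidef.one ht0.le)) (inv_nonneg.2 hcard.le))
  · simp only [traceFst_add, traceFst_smul, traceFst_one_kronecker, smul_smul,
      inv_mul_cancel₀ hcard.ne', inv_mul_cancel_left₀ hcard.ne', one_smul, hΔ]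
    abel
  · simp only [traceFst_add, traceFst_smul, traceFst_one_kronecker, smul_smul,
      inv_mul_cancel_left₀ hcard.ne']
    exact Matrix.PosDef.posSemidef_add (traceFst_posSemidef hY) (Matrix.PosDef.one.smul ht0)
  · have h1 : 0 ≤ pairing ((Fintype.card A : ℝ)⁻¹ • ((1 : Op A) ⊗ₖ Δ)) J :=
      pairing_nonneg (posSemidef_real_smul (posSemidef_kronecker Matrix.PosSemidef.one hΔ0)
        (inv_nonneg.2 hcard.le)) hJ
    have h2 : pairing ((Fintype.card A : ℝ)⁻¹ • ((1 : Op A) ⊗ₖ (t • (1 : Op B)))) J = t := by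
      rw [pairing_smul_left, Matrix.kronecker_smul, pairing_smul_left, Matrix.one_kronecker_one,
        pairing_one_left, htr, Complex.natCast_re, mul_comm t, inv_mul_cancel_left₀ hcard.ne']
    rw [pairing_add_left, pairing_add_left, h2]
    have h3 : k * t < g := by
      calc k * t < c * t := mul_lt_mul_of_pos_right hck ht0
        _ = g := by rw [ht, mul_div_cancel₀ _ hc0.ne']
    rw [mul_add]
    linarith

end Separation

/-! ### Steering form of the dual witness -/

section Steering

variable {A B : Type*} [Fintype A] [DecidableEq A] [Fintype B] [DecidableEq B]

/-- The overlap `⟨s| (id ⊗ K)(Γ) |s⟩` of the Choi matrix of `K` with a vector. -/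
def overlap (s : A × B → ℂ) (K : LMap A B) : ℂ := star s ⬝ᵥ choi K *ᵥ s

lemma overlap_nonneg (s : A × B → ℂ) {K : LMap A B} (hK : IsCP K) : 0 ≤ overlap s K :=
  hK.posSemidef_choi.dotProduct_mulVec_nonneg s

lemma sum_reorder {C D : Type*} [Fintype C] [Fintype D] (f : B → C → B → D → A → A → ℂ) :
    ∑ b, ∑ c, ∑ b', ∑ d, ∑ a, ∑ a', f b c b' d a a' =
      ∑ a, ∑ c, ∑ a', ∑ d, ∑ b, ∑ b', f b c b' d a a' := by
  calc _ = ∑ x : B × C × B × D × A × A,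
        f x.1 x.2.1 x.2.2.1 x.2.2.2.1 x.2.2.2.2.1 x.2.2.2.2.2 := by
        simp only [Fintype.sum_prod_type]
    _ = ∑ x : A × C × A × D × B × B,
        f x.2.2.2.2.1 x.2.1 x.2.2.2.2.2 x.2.2.2.1 x.1 x.2.2.1 :=
      Fintype.sum_equiv
        { toFun := fun x => (x.2.2.2.2.1, x.2.1, x.2.2.2.2.2, x.2.2.2.1, x.1, x.2.2.1)
          invFun := fun x => (x.2.2.2.2.1, x.2.1, x.2.2.2.2.2, x.2.2.2.1, x.1, x.2.2.1)
          left_inv := fun _ => rfl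
          right_inv := fun _ => rfl } _ _ fun _ => rfl
    _ = _ := by simp only [Fintype.sum_prod_type]

/-- Conjugating by `1 ⊗ S⁻¹` normalizes the marginal to `1`, so the result is the Choi matrix of a
channel `B → A`. The vector depends on `S` only, hence operators with the same marginal share it. -/
lemma exists_steering {X : Op (A × B)} (hX : X.PosSemidef) {S : Op B} (hS : IsUnit S.det)
    (hXS : traceFst X = S * Sᴴ) : ∃ E : LMap B A, IsChannel E ∧ ∀ N : LMap A B,
      (overlap (fun p : B × B => star (S p.2 p.1)) (N ∘ₗ E)).re = pairing X (choi N) := by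
  set T : Op B := S⁻¹
  have hTS : T * S = 1 := Matrix.nonsing_inv_mul S hS
  set C : Op (A × B) := ((1 : Op A) ⊗ₖ T) * X * ((1 : Op A) ⊗ₖ T)ᴴ with hC
  have hCX : ((1 : Op A) ⊗ₖ S) * C * ((1 : Op A) ⊗ₖ S)ᴴ = X := by
    have hST : ((1 : Op A) ⊗ₖ S) * ((1 : Op A) ⊗ₖ T) = 1 := by
      rw [← Matrix.mul_kronecker_mul, Matrix.mul_nonsing_inv S hS, one_mul,
        Matrix.one_kronecker_one]
    calc _ = (((1 : Op A) ⊗ₖ S) * ((1 : Op A) ⊗ₖ T)) * X *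
          (((1 : Op A) ⊗ₖ S) * ((1 : Op A) ⊗ₖ T))ᴴ := by
          rw [hC, Matrix.conjTranspose_mul]
          simp only [Matrix.mul_assoc]
      _ = X := by rw [hST, one_mul, Matrix.conjTranspose_one, mul_one]
  have hentry : ∀ (V : Op B) (Z : Op (A × B)) (a a' : A) (b b' : B),
      (((1 : Op A) ⊗ₖ V) * Z * ((1 : Op A) ⊗ₖ V)ᴴ) (a, b) (a', b') =
        ∑ c, ∑ c', V b c * Z (a, c) (a', c') * star (V b' c') := by
    intro V Z a a' b b'
    simp only [Matrix.mul_apply, Fintype.sum_prod_type, Matrix.kroneckerMap_apply,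
      Matrix.conjTranspose_apply, Matrix.one_apply, ite_mul, one_mul, zero_mul,
      apply_ite star, star_zero, mul_ite, mul_zero, Finset.sum_mul]
    simp [Finset.sum_ite_eq]
    rw [Finset.sum_comm]
  have hCt : traceFst C = 1 := by
    have : traceFst C = T * traceFst X * Tᴴ := by
      ext b b'
      simp only [traceFst, Matrix.of_apply, hC, hentry, Matrix.mul_apply, Finset.mul_sum,
        Finset.sum_mul, Matrix.conjTranspose_apply]
      rw [Finset.sum_comm, Finset.sum_comm (s := Finset.univ (α := B)) (t := Finset.univ (α := B))]
      exact Finset.sum_congr rfl fun c _ => Finset.sum_comm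
    rw [this, hXS]
    calc T * (S * Sᴴ) * Tᴴ = (T * S) * (T * S)ᴴ := by
          rw [Matrix.conjTranspose_mul]
          simp only [Matrix.mul_assoc]
      _ = 1 := by rw [hTS, Matrix.conjTranspose_one, mul_one]
  have hCp : C.PosSemidef := hX.mul_mul_conjTranspose_same _
  refine ⟨ofChoi (C.submatrix Prod.swap Prod.swap), ⟨?_, fun Z => ?_⟩, fun N => ?_⟩
  · rw [isCP_iff_choi, choi_ofChoi]
    exact hCp.submatrix _
  · have h : ∀ b b', ∑ a, C (a, b) (a, b') = (1 : Op B) b b' := fun b b' =>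
      congrFun (congrFun hCt b) b'
    simp only [Matrix.trace, Matrix.diag_apply, ofChoi, LinearMap.coe_mk, AddHom.coe_mk,
      Matrix.of_apply, Matrix.submatrix_apply, Prod.swap_prod_mk]
    rw [Finset.sum_comm]
    refine Finset.sum_congr rfl fun b _ => ?_
    rw [Finset.sum_comm]
    simp only [← Finset.mul_sum, h, Matrix.one_apply]
    simp
  · rw [pairing]
    congr 1
    have h1 : ∀ b b' c c', choi (N ∘ₗ ofChoi (C.submatrix Prod.swap Prod.swap)) (b, c) (b', c') =
        ∑ a, ∑ a', C (a, b) (a', b') * choi N (a, c) (a', c') := by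
      intro b b' c c'
      simp only [choi, Matrix.of_apply, LinearMap.comp_apply]
      rw [apply_eq_sum_choi N]
      refine Finset.sum_congr rfl fun a _ => Finset.sum_congr rfl fun a' _ => ?_
      congr 1
      exact congrFun (congrFun (choi_ofChoi (C.submatrix Prod.swap Prod.swap)) (b, a)) (b', a')
    have h2 : ∀ a a' c c', X (a, c) (a', c') =
        ∑ b, ∑ b', S c b * C (a, b) (a', b') * star (S c' b') := by
      intro a a' c c'
      rw [← hentry, hCX]
    simp only [overlap, dotProduct, Matrix.mulVec, Fintype.sum_prod_type, h1, h2, Pi.star_apply,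
      star_star, Finset.mul_sum, Finset.sum_mul]
    rw [sum_reorder]
    refine Finset.sum_congr rfl fun a _ => Finset.sum_congr rfl fun c _ => Finset.sum_congr rfl
      fun a' _ => Finset.sum_congr rfl fun c' _ => Finset.sum_congr rfl fun b _ =>
      Finset.sum_congr rfl fun b' _ => ?_
    ring

/-- A strict gap in the sandwich problem is witnessed by two encoders that are steered from the same
state and by one effect of the receiver. -/
lemma exists_encoders [Nonempty A] {N : LMap A B} (hN : IsChannel N) {k : ℝ}
    (hinf : ∀ P : Op B, ¬(((1 : Op A) ⊗ₖ P - choi N).PosSemidef ∧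
      (k • choi N - (1 : Op A) ⊗ₖ P).PosSemidef)) :
    ∃ (s : B × B → ℂ) (E F : LMap B A), IsChannel E ∧ IsChannel F ∧
      k * (overlap s (N ∘ₗ F)).re < (overlap s (N ∘ₗ E)).re := by
  obtain ⟨X, Y, hX, hY, hXY, hpos, hlt⟩ :=
    exists_dual_witness hN.1.posSemidef_choi (trace_choi hN) hinf
  obtain ⟨S, hS⟩ := exists_eq_conjTranspose_mul_self hpos.posSemidef
  have hdet : IsUnit Sᴴ.det := by
    have h := (Matrix.isUnit_iff_isUnit_det _).1 hpos.isUnit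
    rw [hS, Matrix.det_mul] at h
    exact isUnit_of_mul_isUnit_left h
  have hS' : traceFst Y = Sᴴ * Sᴴᴴ := by rw [hS, Matrix.conjTranspose_conjTranspose]
  obtain ⟨E, hE, hE'⟩ := exists_steering hX hdet (hXY.trans hS')
  obtain ⟨F, hF, hF'⟩ := exists_steering hY hdet hS'
  exact ⟨_, E, F, hE, hF, by rw [hE', hF']; exact hlt⟩

end Steering

/-! ### Achievability -/

section Contract

variable {A P Q : Type*} [Fintype A] [DecidableEq A] [Fintype P] [DecidableEq P] [Fintype Q]

/-- Measuring the effect `F` on the first factor: `W ↦ Tr_P [(F ⊗ 1) W]`. -/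
def contract (F : Op P) : LMap (P × Q) Q where
  toFun W := Matrix.of fun q q' => ∑ p, ∑ p', F p' p * W (p, q) (p', q')
  map_add' X Y := by
    ext q q'
    simp [mul_add, Finset.sum_add_distrib]
  map_smul' c X := by
    ext q q'
    simp [Finset.mul_sum, mul_left_comm]

lemma contract_apply (F : Op P) (W : Op (P × Q)) (q q' : Q) :
    contract F W q q' = ∑ p, ∑ p', F p' p * W (p, q) (p', q') := rfl

lemma isCP_contract {F : Op P} (hF : F.PosSemidef) : IsCP (contract F : LMap (P × Q) Q) := by
  intro r X hX
  have h := posSemidef_sum_snd (ι := Fin r × Q) (posSemidef_hadamard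
    (hF.transpose.submatrix fun y : (Fin r × Q) × P => y.2)
    (hX.submatrix fun y : (Fin r × Q) × P => (y.1.1, (y.2, y.1.2))))
  convert h using 1
  ext p q
  rfl

lemma contract_one (W : Op (P × Q)) : contract 1 W = traceFst W := by
  ext q q'
  simp [contract_apply, Matrix.one_apply, traceFst]

lemma contract_sub (F G : Op P) (W : Op (P × Q)) :
    contract (F - G) W = contract F W - contract G W := by
  ext q q'
  simp [contract_apply, sub_mul, Finset.sum_sub_distrib]

/-- The complementary effect contributes a nonnegative trace, and the two contributions add up to
the full trace. -/
lemma isSubchannel_contract {F : Op P} (hF : F.PosSemidef) (hF' : (1 - F).PosSemidef) :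
    IsSubchannel (contract F : LMap (P × Q) Q) := by
  refine ⟨isCP_contract hF, fun X hX => ?_⟩
  have h := re_trace_nonneg ((isCP_contract (Q := Q) hF').posSemidef hX)
  rw [contract_sub, contract_one, Matrix.trace_sub, trace_traceFst, Complex.sub_re] at h
  linarith

/-- This is Cauchy–Schwarz; for `s = 0` the inverse is `0` and the subtracted term vanishes. -/
lemma posSemidef_one_sub_vecMulVec (s : P → ℂ) :
    (1 - (∑ i, ‖s i‖ ^ 2)⁻¹ • Matrix.vecMulVec s (star s)).PosSemidef := by
  have hs : 0 ≤ ∑ i, ‖s i‖ ^ 2 := Finset.sum_nonneg fun i _ => sq_nonneg _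
  rw [posSemidef_iff_re]
  refine ⟨Matrix.isHermitian_one.sub
    (posSemidef_real_smul (posSemidef_vecMulVec s) (inv_nonneg.2 hs)).isHermitian, fun w => ?_⟩
  rw [Matrix.sub_mulVec, Matrix.one_mulVec, Matrix.smul_mulVec, dotProduct_sub, dotProduct_smul,
    Complex.sub_re, star_dotProduct_self, Complex.real_smul, Complex.re_ofReal_mul,
    Matrix.vecMulVec_mulVec, sub_nonneg]
  have h1 : (star w ⬝ᵥ MulOpposite.op (star s ⬝ᵥ w) • s).re = ‖star s ⬝ᵥ w‖ ^ 2 := by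
    have : star w ⬝ᵥ MulOpposite.op (star s ⬝ᵥ w) • s =
        (star s ⬝ᵥ w) * star (star s ⬝ᵥ w) := by
      rw [dotProduct_smul, op_smul_eq_mul, Matrix.star_dotProduct, mul_comm]
    rw [this, Complex.star_def, Complex.mul_conj, Complex.ofReal_re, Complex.normSq_eq_norm_sq]
  rw [h1]
  have h2 : ‖star s ⬝ᵥ w‖ ^ 2 ≤ (∑ i, ‖s i‖ ^ 2) * ∑ i, ‖w i‖ ^ 2 := by
    refine le_trans ?_ (Finset.sum_mul_sq_le_sq_mul_sq Finset.univ (fun i => ‖s i‖) fun i => ‖w i‖)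
    refine pow_le_pow_left₀ (norm_nonneg _) ((norm_sum_le _ _).trans_eq ?_) 2
    simp
  rcases hs.eq_or_lt with h0 | h0
  · rw [← h0, _root_.inv_zero, zero_mul]
    exact Finset.sum_nonneg fun i _ => sq_nonneg _
  · rw [inv_mul_le_iff₀ h0]
    exact h2

end Contract

/-! ### The postselected protocol and its effective map. -/

section Protocol

variable {A B M M' Q : Type*} [Fintype A] [DecidableEq A] [Fintype B] [DecidableEq B] [Fintype M]
  [DecidableEq M] [Fintype M'] [DecidableEq M'] [Fintype Q] [DecidableEq Q]

/-- Alice measures `F` on the message and her share of `γ₀`, and encodes her share of the second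
entangled pair with `E` if the outcome is `F`, and with `E'` otherwise. -/
def conditionalEncoder (F : Op (M × Q)) (E E' : LMap B A) : LMap (M × (Q × B)) A :=
  E ∘ₗ contract F ∘ₗ relabel (Equiv.prodAssoc M Q B) +
    E' ∘ₗ contract (1 - F) ∘ₗ relabel (Equiv.prodAssoc M Q B)

lemma isChannel_conditionalEncoder {F : Op (M × Q)} (hF : F.PosSemidef)
    (hF' : (1 - F).PosSemidef) {E E' : LMap B A} (hE : IsChannel E) (hE' : IsChannel E') :
    IsChannel (conditionalEncoder F E E') := by
  refine ⟨(hE.1.comp ((isCP_contract hF).comp (isCP_relabel _))).add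
    (hE'.1.comp ((isCP_contract hF').comp (isCP_relabel _))), fun X => ?_⟩
  simp only [conditionalEncoder, LinearMap.add_apply, LinearMap.comp_apply, Matrix.trace_add, hE.2,
    hE'.2, contract_sub, contract_one, Matrix.trace_sub, trace_traceFst, relabel_apply,
    trace_submatrix_equiv]
  ring

/-- Bob's decoder: the effect `|s⟩⟨s|`, normalized, on the channel output and his share of the
second pair. -/
def effectDecoder (M' : Type*) (s : B × B → ℂ) : LMap (B × (M' × B)) M' :=
  contract ((∑ i, ‖s i‖ ^ 2)⁻¹ • Matrix.vecMulVec s (star s)) ∘ₗ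
    relabel fun x : (B × B) × M' => (x.1.2, (x.2, x.1.1))

lemma isSubchannel_effectDecoder (s : B × B → ℂ) :
    IsSubchannel (effectDecoder M' s) := by
  refine (isSubchannel_contract (posSemidef_real_smul (posSemidef_vecMulVec s)
    (inv_nonneg.2 (Finset.sum_nonneg fun i _ => sq_nonneg _)))
    (posSemidef_one_sub_vecMulVec s)).comp (isSubchannel_relabel_injective fun x y h => ?_)
  simp only [Prod.mk.injEq] at h
  exact Prod.ext (Prod.ext h.2.2 h.1) h.2.1

/-- The shared state: `γ₀` and a maximally entangled pair. -/
def sharedState (B : Type*) [Fintype B] [DecidableEq B] (γ₀ : Op (Q × M')) :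
    Op ((Q × B) × (M' × B)) :=
  (γ₀ ⊗ₖ maxEnt (Equiv.refl B)).submatrix (Equiv.prodProdProdComm Q B M' B)
    (Equiv.prodProdProdComm Q B M' B)

lemma isState_sharedState [Nonempty B] {γ₀ : Op (Q × M')} (hγ₀ : IsState γ₀) :
    IsState (sharedState B γ₀) :=
  ⟨(posSemidef_kronecker hγ₀.1 (posSemidef_maxEnt _)).submatrix _, by
    rw [sharedState, trace_submatrix_equiv, Matrix.trace_kronecker, hγ₀.2,
      (isState_maxEnt (Equiv.refl B)).2, one_mul]⟩

/-- The postselected protocol with a two-outcome measurement of the sender. -/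
def protocol (γ₀ : Op (Q × M')) (F : Op (M × Q)) (E E' : LMap B A) (s : B × B → ℂ) :
    Supermap A B M M' :=
  assisted (encode (sharedState B γ₀) (conditionalEncoder F E E')) (effectDecoder M' s)

lemma isPEA_protocol [Nonempty B] {γ₀ : Op (Q × M')} (hγ₀ : IsState γ₀) {F : Op (M × Q)}
    (hF : F.PosSemidef) (hF' : (1 - F).PosSemidef) {E E' : LMap B A} (hE : IsChannel E)
    (hE' : IsChannel E') (s : B × B → ℂ) : IsPEA (protocol γ₀ F E E' s) :=
  isPEA_assisted (isState_sharedState hγ₀) (isChannel_conditionalEncoder hF hF' hE hE')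
    (isSubchannel_effectDecoder s)

/-- The effective map on the message when the measurement outcome is `F`. -/
def outcome (γ₀ : Op (Q × M')) (F : Op (M × Q)) : LMap M M' := contract F ∘ₗ append M γ₀

/-- The block of Bob's registers at `(m, b)`, `(m', b')` leaves Alice's half of the second pair in
the matrix unit `|b⟩⟨b'|`, with a weight depending on the message alone. The encoder thus acts on
half of an entangled pair, so Choi matrices appear. -/
lemma contract_append_sharedState (γ₀ : Op (Q × M')) (F : Op (M × Q)) (ρ : Op M) (m m' : M')
    (b b' : B) :
    contract F (relabel (Equiv.prodAssoc M Q B) (Matrix.of fun x x' =>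
      append M (sharedState B γ₀) ρ (x, (m, b)) (x', (m', b')))) =
      ((Fintype.card B : ℂ)⁻¹ * outcome γ₀ F ρ m m') • Matrix.single b b' 1 := by
  ext c c'
  simp only [contract_apply, relabel_apply, Matrix.submatrix_apply, Matrix.of_apply, append_apply,
    sharedState, Matrix.kroneckerMap_apply, maxEnt_apply, Matrix.smul_apply, outcome,
    LinearMap.comp_apply, smul_eq_mul, Matrix.single_apply]
  by_cases h : b = c <;> by_cases h' : b' = c'
  · subst h h'
    simp only [Equiv.prodAssoc_apply, Equiv.prodProdProdComm_apply, Equiv.refl_apply, if_true,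
      and_self, mul_one, Finset.mul_sum]
    exact Finset.sum_congr rfl fun p _ => Finset.sum_congr rfl fun p' _ => by ring
  · simp [h, h', Ne.symm h']
  · simp [h, h', Ne.symm h]
  · simp [h, h', Ne.symm h]

/-- The two measurement outcomes contribute separately, each weighted by the probability, up to a
common factor, that Bob's effect fires after the matching encoder. -/
lemma protocol_apply (γ₀ : Op (Q × M')) (F : Op (M × Q)) (E E' : LMap B A) (s : B × B → ℂ)
    (N : LMap A B) (ρ : Op M) :
    protocol γ₀ F E E' s N ρ = (((∑ i, ‖s i‖ ^ 2)⁻¹ * (Fintype.card B : ℝ)⁻¹ : ℝ) : ℂ) •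
      (overlap s (N ∘ₗ E) • outcome γ₀ F ρ + overlap s (N ∘ₗ E') • outcome γ₀ (1 - F) ρ) := by
  have h1 : ∀ (m m' : M') (b b' : B), (Matrix.of fun a a' =>
      encode (sharedState B γ₀) (conditionalEncoder F E E') ρ (a, (m, b)) (a', (m', b'))) =
      ((Fintype.card B : ℂ)⁻¹ * outcome γ₀ F ρ m m') • E (Matrix.single b b' 1) +
      ((Fintype.card B : ℂ)⁻¹ * outcome γ₀ (1 - F) ρ m m') • E' (Matrix.single b b' 1) := by
    intro m m' b b'
    rw [← map_smul, ← map_smul, ← contract_append_sharedState, ← contract_append_sharedState]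
    rfl
  ext m m'
  rw [protocol, assisted_apply, effectDecoder, LinearMap.comp_apply, contract_apply]
  simp only [relabel_apply, Matrix.submatrix_apply, tensorId_apply, h1, map_add, map_smul]
  simp only [Matrix.add_apply, Matrix.smul_apply, smul_eq_mul, overlap, dotProduct, Matrix.mulVec,
    Finset.sum_mul, Finset.mul_sum, ← Finset.sum_add_distrib, Matrix.vecMulVec_apply,
    Complex.real_smul]
  refine Finset.sum_congr rfl fun p _ => Finset.sum_congr rfl fun p' _ => ?_
  simp only [choi, Matrix.of_apply, LinearMap.comp_apply]
  push_cast
  ring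

end Protocol

/-! ### The two blind guesses: shared randomness and postselected teleportation. -/

section OneShot

variable {A B : Type*} [Fintype A] [DecidableEq A] [Fintype B] [DecidableEq B]

lemma outcome_one {M M' Q : Type*} [Fintype M] [DecidableEq M] [Fintype M'] [Fintype Q]
    [DecidableEq Q] (γ₀ : Op (Q × M')) (ρ : Op M) :
    outcome γ₀ 1 ρ = ρ.trace • traceFst γ₀ := by
  rw [outcome, LinearMap.comp_apply, contract_one]
  ext m m'
  simp [traceFst, append_apply, Fintype.sum_prod_type, Matrix.trace, Finset.sum_mul_sum]

lemma outcome_one_sub {M M' Q : Type*} [Fintype M] [DecidableEq M] [Fintype M'] [Fintype Q]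
    [DecidableEq Q] (γ₀ : Op (Q × M')) (F : Op (M × Q)) (ρ : Op M) :
    outcome γ₀ (1 - F) ρ = ρ.trace • traceFst γ₀ - outcome γ₀ F ρ := by
  rw [← outcome_one]
  exact contract_sub _ _ _

/-- Classically correlated effect. -/
def diagEffect (d : ℕ) : Op (Fin d × Fin d) :=
  Matrix.diagonal fun p => if p.1 = p.2 then 1 else 0

lemma posSemidef_diagEffect (d : ℕ) : (diagEffect d).PosSemidef :=
  Matrix.posSemidef_diagonal_iff.2 fun p => by split_ifs <;> simp

lemma posSemidef_one_sub_diagEffect (d : ℕ) : (1 - diagEffect d).PosSemidef := by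
  rw [diagEffect, ← Matrix.diagonal_one, Matrix.diagonal_sub]
  exact Matrix.posSemidef_diagonal_iff.2 fun p => by split_ifs <;> simp

lemma isState_diagEffect {d : ℕ} (hd : 1 ≤ d) : IsState ((d : ℝ)⁻¹ • diagEffect d) := by
  refine ⟨posSemidef_real_smul (posSemidef_diagEffect d) (by positivity), ?_⟩
  have : (d : ℂ) ≠ 0 := by exact_mod_cast (by omega : d ≠ 0)
  rw [diagEffect, Matrix.trace_smul, Matrix.trace_diagonal, Fintype.sum_prod_type]
  simp [this]

/-- Alice compares the message with shared randomness; they agree with probability `1 / d`, and then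
Bob's copy is the message. -/
lemma outcome_diagEffect (d : ℕ) (m : Fin d) :
    outcome ((d : ℝ)⁻¹ • diagEffect d) (diagEffect d) (Matrix.single m m 1) =
      (d : ℂ)⁻¹ • Matrix.single m m 1 := by
  ext i j
  simp [outcome, contract_apply, append_apply, diagEffect, Matrix.diagonal_apply,
    Fintype.sum_prod_type, Matrix.single_apply, Prod.ext_iff, ite_and]
  by_cases h : i = j
  · subst h
    by_cases h' : m = i <;> simp [h']
  · by_cases h' : m = i
    · subst h'
      simp [h]
    · simp [h']

lemma traceFst_diagEffect (d : ℕ) :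
    traceFst ((d : ℝ)⁻¹ • diagEffect d) = (d : ℂ)⁻¹ • 1 := by
  ext i j
  simp [traceFst, diagEffect, Matrix.diagonal_apply, Matrix.one_apply, Prod.ext_iff]

/-- Teleportation without correction: projecting message and share onto the maximally entangled
state succeeds with probability `1 / d²`. -/
lemma outcome_maxEnt (d : ℕ) (ρ : Op (Fin d)) :
    outcome (maxEnt (Equiv.refl (Fin d))) (maxEnt (Equiv.refl (Fin d))) ρ =
      ((d : ℂ)⁻¹ ^ 2) • ρ := by
  ext i j
  simp [outcome, contract_apply, append_apply, maxEnt_apply, Fintype.sum_prod_type]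
  ring

lemma traceFst_maxEnt (d : ℕ) :
    traceFst (maxEnt (Equiv.refl (Fin d))) = (d : ℂ)⁻¹ • 1 := by
  ext i j
  simp [traceFst, maxEnt_apply, Matrix.one_apply]

end OneShot

/-! ### One-shot achievability. -/

section OneShotError

variable {A B : Type*} [Fintype A] [DecidableEq A] [Fintype B] [DecidableEq B]

/-- The right and wrong weights are `p` and `D q`, and `(1 - ε) D q ≤ ε κ q ≤ ε p`. For the two
protocols `D` is `d - 1` and `d² - 1`, the prior odds against the guess. -/
lemma conditional_success {c p q D κ ε : ℝ} (hc : 0 < c) (hp : 0 < p) (hq : 0 ≤ q) (hD : 0 ≤ D)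
    (hε : 0 < ε) (hκ : κ * q ≤ p) (h : D * (1 - ε) ≤ ε * κ) :
    1 - ε ≤ (c * p) / (c * (p + D * q)) := by
  rw [mul_div_mul_left _ _ hc.ne', le_div_iff₀ (by positivity)]
  have h1 : D * (1 - ε) * q ≤ ε * κ * q := mul_le_mul_of_nonneg_right h hq
  have h2 : ε * (κ * q) ≤ ε * p := mul_le_mul_of_nonneg_left hκ hε.le
  nlinarith

lemma overlap_eq_ofReal (s : A × B → ℂ) {K : LMap A B} (hK : IsCP K) :
    overlap s K = ((overlap s K).re : ℂ) := by
  apply Complex.ext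
  · simp
  · simpa using (Complex.le_def.1 (overlap_nonneg s hK)).2.symm

lemma sum_sq_pos_of_overlap_pos {s : A × B → ℂ} {K : LMap A B} (h : 0 < (overlap s K).re) :
    0 < ∑ i, ‖s i‖ ^ 2 := by
  have : s ≠ 0 := by
    rintro rfl
    simp [overlap] at h
  obtain ⟨i, hi⟩ := Function.ne_iff.1 this
  exact Finset.sum_pos' (fun i _ => sq_nonneg _) ⟨i, Finset.mem_univ i, by
    have : 0 < ‖s i‖ := norm_pos_iff.2 hi
    positivity⟩

lemma exists_isPEA_errC_le [Nonempty B] {N : LMap A B} (hN : IsChannel N)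
    {s : B × B → ℂ} {E E' : LMap B A} (hE : IsChannel E) (hE' : IsChannel E') {κ : ℝ}
    (hκ : κ * (overlap s (N ∘ₗ E')).re ≤ (overlap s (N ∘ₗ E)).re)
    (hpos : 0 < (overlap s (N ∘ₗ E)).re) {d : ℕ} (hd : 1 ≤ d) {ε : ℝ} (hε : 0 < ε)
    (h : ((d : ℝ) - 1) * (1 - ε) ≤ ε * κ) :
    ∃ Θ : Supermap A B (Fin d) (Fin d), IsPEA Θ ∧ errC Θ N ≤ ε := by
  have : Nonempty (Fin d) := ⟨⟨0, hd⟩⟩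
  have hd0 : (0 : ℝ) < d := by exact_mod_cast hd
  have hd1 : (1 : ℝ) ≤ d := by exact_mod_cast hd
  have hdC : (d : ℂ) ≠ 0 := by exact_mod_cast hd0.ne'
  refine ⟨protocol ((d : ℝ)⁻¹ • diagEffect d) (diagEffect d) E E' s,
    isPEA_protocol (isState_diagEffect hd) (posSemidef_diagEffect d)
      (posSemidef_one_sub_diagEffect d) hE hE' s, ?_⟩
  set p := (overlap s (N ∘ₗ E)).re with hp
  set q := (overlap s (N ∘ₗ E')).re with hq
  set c : ℝ := (∑ i, ‖s i‖ ^ 2)⁻¹ * (Fintype.card B : ℝ)⁻¹ with hc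
  have hc0 : 0 < c := by
    have h1 := sum_sq_pos_of_overlap_pos hpos
    have h2 : (0 : ℝ) < Fintype.card B := by exact_mod_cast Fintype.card_pos
    positivity
  have hq0 : 0 ≤ q := (Complex.le_def.1 (overlap_nonneg s (hN.1.comp hE'.1))).1
  have key : ∀ m : Fin d, protocol ((d : ℝ)⁻¹ • diagEffect d) (diagEffect d) E E' s N
      (Matrix.single m m 1) = (c : ℂ) • ((p : ℂ) • ((d : ℂ)⁻¹ • Matrix.single m m 1) +
        (q : ℂ) • ((d : ℂ)⁻¹ • 1 - (d : ℂ)⁻¹ • Matrix.single m m 1)) := by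
    intro m
    rw [protocol_apply, overlap_eq_ofReal s (hN.1.comp hE.1),
      overlap_eq_ofReal s (hN.1.comp hE'.1), outcome_one_sub, outcome_diagEffect,
      traceFst_diagEffect, Matrix.trace_single_eq_same, one_smul]
  rw [errC, sub_le_comm]
  refine le_ciInf fun m => ?_
  have e1 : (protocol ((d : ℝ)⁻¹ • diagEffect d) (diagEffect d) E E' s N
      (Matrix.single m m 1) m m).re = (c / d) * p := by
    rw [key, ← Complex.ofReal_re (c / d * p)]
    congr 1
    simp
    ring
  have e2 : (protocol ((d : ℝ)⁻¹ • diagEffect d) (diagEffect d) E E' s N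
      (Matrix.single m m 1)).trace.re = (c / d) * (p + ((d : ℝ) - 1) * q) := by
    rw [key, ← Complex.ofReal_re (c / d * (p + ((d : ℝ) - 1) * q))]
    congr 1
    simp [Matrix.trace_smul, Matrix.trace_add, Matrix.trace_sub, hdC]
    field_simp
  rw [e1, e2]
  exact conditional_success (div_pos hc0 hd0) hpos hq0 (by linarith) hε hκ h

lemma exists_isPEA_errQ_le [Nonempty B] {N : LMap A B} (hN : IsChannel N)
    {s : B × B → ℂ} {E E' : LMap B A} (hE : IsChannel E) (hE' : IsChannel E') {κ : ℝ}
    (hκ : κ * (overlap s (N ∘ₗ E')).re ≤ (overlap s (N ∘ₗ E)).re)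
    (hpos : 0 < (overlap s (N ∘ₗ E)).re) {d : ℕ} (hd : 1 ≤ d) {ε : ℝ} (hε : 0 < ε)
    (h : ((d : ℝ) ^ 2 - 1) * (1 - ε) ≤ ε * κ) :
    ∃ Θ : Supermap A B (Fin d) (Fin d), IsPEA Θ ∧ errQ Θ N ≤ ε := by
  have : Nonempty (Fin d) := ⟨⟨0, hd⟩⟩
  have hd0 : (0 : ℝ) < d := by exact_mod_cast hd
  have hd1 : (1 : ℝ) ≤ d := by exact_mod_cast hd
  have hdC : (d : ℂ) ≠ 0 := by exact_mod_cast hd0.ne'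
  set Φ := maxEnt (Equiv.refl (Fin d)) with hΦ
  have hΦ1 : (1 - Φ).PosSemidef := by
    have := posSemidef_one_sub_vecMulVec (maxEntVec (Equiv.refl (Fin d)))
    rwa [sum_norm_maxEntVec, inv_one, one_smul] at this
  refine ⟨protocol Φ Φ E E' s, isPEA_protocol (isState_maxEnt _) (posSemidef_maxEnt _) hΦ1 hE hE' s,
    ?_⟩
  set p := (overlap s (N ∘ₗ E)).re with hp
  set q := (overlap s (N ∘ₗ E')).re with hq
  set c : ℝ := (∑ i, ‖s i‖ ^ 2)⁻¹ * (Fintype.card B : ℝ)⁻¹ with hc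
  have hc0 : 0 < c := by
    have h1 := sum_sq_pos_of_overlap_pos hpos
    have h2 : (0 : ℝ) < Fintype.card B := by exact_mod_cast Fintype.card_pos
    positivity
  have hq0 : 0 ≤ q := (Complex.le_def.1 (overlap_nonneg s (hN.1.comp hE'.1))).1
  have key : protocol Φ Φ E E' s N = (c : ℂ) • ((p : ℂ) • ((d : ℂ)⁻¹ ^ 2 • LinearMap.id) +
        (q : ℂ) • outcome Φ (1 - Φ)) := by
    refine LinearMap.ext fun ρ => ?_
    rw [protocol_apply, overlap_eq_ofReal s (hN.1.comp hE.1),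
      overlap_eq_ofReal s (hN.1.comp hE'.1), outcome_maxEnt]
    rfl
  have hG : IsCP (outcome Φ (1 - Φ)) := (isCP_contract hΦ1).comp (isCP_append (posSemidef_maxEnt _))
  have hGt : ∀ X, (outcome Φ (1 - Φ) X).trace = (1 - (d : ℂ)⁻¹ ^ 2) * X.trace := by
    intro X
    rw [outcome_one_sub, hΦ, outcome_maxEnt, traceFst_maxEnt]
    simp [Matrix.trace_smul, Matrix.trace_sub, hdC]
    ring
  rw [errQ, sub_le_comm]
  refine le_csInf ⟨_, d, maxEntVec (Equiv.refl (Fin d)), sum_norm_maxEntVec _, rfl⟩ ?_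
  rintro _ ⟨r, v, hv, rfl⟩
  set ψ := Matrix.vecMulVec v (star v) with hψ
  have hψp : ψ.PosSemidef := posSemidef_vecMulVec v
  have hvv : star v ⬝ᵥ v = 1 := by
    apply Complex.ext
    · rw [star_dotProduct_self, hv, Complex.one_re]
    · simpa using (Complex.le_def.1 (dotProduct_star_self_nonneg v)).2.symm
  have hψt : ψ.trace = 1 := by
    rw [hψ, Matrix.trace_vecMulVec, dotProduct_comm, hvv]
  have hψψ : ψ * ψ = ψ := by
    rw [hψ, Matrix.vecMulVec_mul_vecMulVec, hvv, one_smul]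
  have hid : idTensor (Fin r) (protocol Φ Φ E E' s N) ψ = (c : ℂ) • ((p : ℂ) •
      ((d : ℂ)⁻¹ ^ 2 • ψ) + (q : ℂ) • idTensor (Fin r) (outcome Φ (1 - Φ)) ψ) := by
    rw [key]
    rfl
  set w := (ψ * idTensor (Fin r) (outcome Φ (1 - Φ)) ψ).trace with hw
  have hw0 : 0 ≤ w.re := re_trace_vecMulVec_mul_nonneg (hG.posSemidef_idTensor hψp)
  have hwt : (idTensor (Fin r) (outcome Φ (1 - Φ)) ψ).trace = 1 - (d : ℂ)⁻¹ ^ 2 := by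
    rw [trace_idTensor]
    simp only [hGt]
    rw [← Finset.mul_sum]
    have : ∑ i, (Matrix.of fun a a' => ψ (i, a) (i, a')).trace = ψ.trace := by
      simp [Matrix.trace, Fintype.sum_prod_type]
    rw [this, hψt, mul_one]
  have e1 : (ψ * idTensor (Fin r) (protocol Φ Φ E E' s N) ψ).trace.re =
      (c / (d : ℝ) ^ 2) * p + c * q * w.re := by
    have : (ψ * idTensor (Fin r) (protocol Φ Φ E E' s N) ψ).trace =
        (((c / (d : ℝ) ^ 2) * p : ℝ) : ℂ) + ((c * q : ℝ) : ℂ) * w := by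
      rw [hid, Matrix.mul_smul, Matrix.mul_add, Matrix.mul_smul, Matrix.mul_smul, Matrix.mul_smul,
        hψψ, Matrix.trace_smul, Matrix.trace_add, Matrix.trace_smul, Matrix.trace_smul,
        Matrix.trace_smul, hψt, ← hw]
      simp
      field_simp
    rw [this, Complex.add_re, Complex.ofReal_re, Complex.re_ofReal_mul]
  have e2 : (idTensor (Fin r) (protocol Φ Φ E E' s N) ψ).trace.re =
      (c / (d : ℝ) ^ 2) * (p + ((d : ℝ) ^ 2 - 1) * q) := by
    rw [hid, Matrix.trace_smul, Matrix.trace_add, Matrix.trace_smul, Matrix.trace_smul,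
        Matrix.trace_smul, hwt, hψt,
        ← Complex.ofReal_re ((c / (d : ℝ) ^ 2) * (p + ((d : ℝ) ^ 2 - 1) * q))]
    congr 1
    simp
    field_simp
  rw [e1, e2]
  have hD : (0 : ℝ) ≤ (d : ℝ) ^ 2 - 1 := by nlinarith
  -- The failure branch also overlaps with `ψ`; this contribution is nonnegative and can only
  -- increase the ratio.
  refine (conditional_success (div_pos hc0 (pow_pos hd0 2)) hpos hq0 hD hε hκ h).trans ?_
  have : 0 < c / (d : ℝ) ^ 2 := div_pos hc0 (pow_pos hd0 2)
  gcongr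
  have : 0 ≤ c * q * w.re := by positivity
  linarith

end OneShotError

/-! ### Multiplicativity of overlaps. -/

section OverlapPow

variable {A B : Type*} [Fintype A] [DecidableEq A] [Fintype B] [DecidableEq B]

lemma overlap_tensorPow (n : ℕ) (s : A × B → ℂ) (K : LMap A B) :
    overlap (fun p : (Fin n → A) × (Fin n → B) => ∏ i, s (p.1 i, p.2 i)) (tensorPow n K) =
      overlap s K ^ n := by
  have h : ∀ f : (Fin n → A) × (Fin n → B) → ℂ,
      ∑ p, f p = ∑ x : Fin n → A × B, f (fun i => (x i).1, fun i => (x i).2) := fun f =>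
    (Fintype.sum_equiv (Equiv.arrowProdEquivProdArrow (Fin n) (fun _ => A) (fun _ => B)) _ _
      fun _ => rfl).symm
  simp only [overlap, dotProduct, Matrix.mulVec, Pi.star_apply, choi_tensorPow, h, star_prod,
    ← Finset.prod_mul_distrib]
  have h2 : ∀ x : Fin n → A × B, ∑ y : Fin n → A × B, ∏ i, choi K (x i) (y i) * s (y i) =
      ∏ i, ∑ y, choi K (x i) y * s y := fun x => sum_prod_pi fun i y => choi K (x i) y * s y
  simp only [Prod.mk.eta, h2, ← Finset.prod_mul_distrib]
  rw [sum_prod_pi fun _ x => star (s x) * ∑ y, choi K x y * s y]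
  simp

end OverlapPow

/-! ### Asymptotics -/

section Limits

lemma tendsto_affine_div (x c : ℝ) :
    Tendsto (fun n : ℕ => (((1 / n : ℝ) * (n * x + c) : ℝ) : EReal)) atTop (nhds (x : EReal)) := by
  refine (continuous_coe_real_ereal.tendsto x).comp ?_
  have h : Tendsto (fun n : ℕ => x + c * (1 / (n : ℝ))) atTop (nhds (x + c * 0)) :=
    tendsto_const_nhds.add (tendsto_const_nhds.mul tendsto_one_div_atTop_nhds_zero_nat)
  rw [mul_zero, add_zero] at h
  refine h.congr' ?_
  filter_upwards [eventually_gt_atTop 0] with n hn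
  have : (n : ℝ) ≠ 0 := by exact_mod_cast hn.ne'
  field_simp

lemma limsup_le_of_le_affine {o : ℕ → EReal} {x : ℝ} (c : ℝ)
    (h : ∀ n : ℕ, o n ≤ (((n : ℝ) * x + c : ℝ) : EReal)) :
    limsup (fun n : ℕ => ((1 / n : ℝ) : EReal) * o n) atTop ≤ x := by
  rw [← (tendsto_affine_div x c).limsup_eq]
  refine limsup_le_limsup (.of_forall fun n => ?_)
  simp only [EReal.coe_mul]
  exact mul_le_mul_of_nonneg_left (h n) (EReal.coe_nonneg.2 (by positivity))

lemma le_liminf_of_affine_le {o : ℕ → EReal} {x : ℝ} (c : ℝ)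
    (h : ∀ n : ℕ, (((n : ℝ) * x + c : ℝ) : EReal) ≤ o n) :
    x ≤ liminf (fun n : ℕ => ((1 / n : ℝ) : EReal) * o n) atTop := by
  rw [← (tendsto_affine_div x c).liminf_eq]
  refine liminf_le_liminf (.of_forall fun n => ?_)
  simp only [EReal.coe_mul]
  exact mul_le_mul_of_nonneg_left (h n) (EReal.coe_nonneg.2 (by positivity))

lemma one_div_mul_le {n : ℕ} {a b : EReal} (h : a ≤ b) :
    ((1 / n : ℝ) : EReal) * a ≤ ((1 / n : ℝ) : EReal) * b :=
  mul_le_mul_of_nonneg_left h (EReal.coe_nonneg.2 (by positivity))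

end Limits

universe u v

/-! ### From one-shot bounds to capacities. -/

section Capacities

variable {A : Type u} {B : Type v} [Fintype A] [DecidableEq A] [Fintype B] [DecidableEq B]

section Order

variable (N : LMap A B)

lemma oneShotC_pEA_le {A : Type u} {B : Type v} [Fintype A] [DecidableEq A] [Fintype B]
    [DecidableEq B] (ε : ℝ) (N : LMap A B) : oneShotC pEA ε N ≤ oneShotC pNA ε N := by
  refine sSup_le_sSup ?_
  rintro _ ⟨d, Θ, hd, hΘ, herr, rfl⟩
  have : Nonempty (Fin d) := ⟨⟨0, hd⟩⟩
  exact ⟨d, Θ, hd, IsPEA.isPNA hΘ, herr, rfl⟩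

lemma oneShotQ_pEA_le {A : Type u} {B : Type v} [Fintype A] [DecidableEq A] [Fintype B]
    [DecidableEq B] (ε : ℝ) (N : LMap A B) : oneShotQ pEA ε N ≤ oneShotQ pNA ε N := by
  refine sSup_le_sSup ?_
  rintro _ ⟨d, Θ, hd, hΘ, herr, rfl⟩
  have : Nonempty (Fin d) := ⟨⟨0, hd⟩⟩
  exact ⟨d, Θ, hd, IsPEA.isPNA hΘ, herr, rfl⟩

lemma capC_pEA_le : capC pEA N ≤ capC pNA N :=
  iInf_mono fun _ => liminf_le_liminf (.of_forall fun _ => one_div_mul_le (oneShotC_pEA_le _ _))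

lemma capQ_pEA_le : capQ pEA N ≤ capQ pNA N :=
  iInf_mono fun _ => liminf_le_liminf (.of_forall fun _ => one_div_mul_le (oneShotQ_pEA_le _ _))

lemma strongC_pEA_le : strongC pEA N ≤ strongC pNA N :=
  iSup_mono fun _ => limsup_le_limsup (.of_forall fun _ => one_div_mul_le (oneShotC_pEA_le _ _))

lemma strongQ_pEA_le : strongQ pEA N ≤ strongQ pNA N :=
  iSup_mono fun _ => limsup_le_limsup (.of_forall fun _ => one_div_mul_le (oneShotQ_pEA_le _ _))

lemma capC_le_strongC (T : SupermapClass.{u, v}) : capC T N ≤ strongC T N :=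
  let ε : Set.Ioo (0 : ℝ) 1 := ⟨1 / 2, by norm_num, by norm_num⟩
  (iInf_le _ ε).trans (le_trans liminf_le_limsup (le_iSup_of_le ε le_rfl))

lemma capQ_le_strongQ (T : SupermapClass.{u, v}) : capQ T N ≤ strongQ T N :=
  let ε : Set.Ioo (0 : ℝ) 1 := ⟨1 / 2, by norm_num, by norm_num⟩
  (iInf_le _ ε).trans (le_trans liminf_le_limsup (le_iSup_of_le ε le_rfl))

end Order

variable [Nonempty A] {N : LMap A B}

lemma strongC_pNA_le (hN : IsChannel N) {x : ℝ} (hx : IOmega N < x) : strongC pNA N ≤ x := by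
  obtain ⟨σ, k, l, hσ, hk, hl, hc, hlog⟩ := exists_isComparable_of_IOmega_lt hN hx
  refine iSup_le fun ε => limsup_le_of_le_affine (-Real.logb 2 (1 - ε)) fun n => sSup_le ?_
  rintro _ ⟨d, Θ, hd, hΘ, herr, rfl⟩
  have hε : 0 < 1 - (ε : ℝ) := by linarith [ε.2.2]
  have hd0 : (0 : ℝ) < d := by exact_mod_cast hd
  have h := le_of_errC_le hd hΘ (isChannel_tensorPow n hN) (isState_opPow n hσ) (pow_pos hk n)
    (pow_pos hl n) (hc.tensorPow hN.1 hσ.1 n) ε.2.2 herr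
  have h2 := Real.logb_le_logb_of_le one_lt_two (mul_pos hd0 hε) h
  rw [Real.logb_mul hd0.ne' hε.ne', Real.logb_mul (pow_pos hk n).ne' (pow_pos hl n).ne',
    Real.logb_pow, Real.logb_pow, ← mul_add] at h2
  have h3 := mul_le_mul_of_nonneg_left hlog.le (Nat.cast_nonneg (α := ℝ) n)
  exact EReal.coe_le_coe_iff.2 (by linarith)

lemma strongQ_pNA_le (hN : IsChannel N) {x : ℝ} (hx : IOmega N < x) :
    strongQ pNA N ≤ ((x / 2 : ℝ) : EReal) := by
  obtain ⟨σ, k, l, hσ, hk, hl, hc, hlog⟩ := exists_isComparable_of_IOmega_lt hN hx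
  refine iSup_le fun ε => limsup_le_of_le_affine (-Real.logb 2 (1 - ε) / 2) fun n => sSup_le ?_
  rintro _ ⟨d, Θ, hd, hΘ, herr, rfl⟩
  have hε : 0 < 1 - (ε : ℝ) := by linarith [ε.2.2]
  have hd0 : (0 : ℝ) < d := by exact_mod_cast hd
  have h := le_of_errQ_le hd hΘ (isChannel_tensorPow n hN) (isState_opPow n hσ) (pow_pos hk n)
    (pow_pos hl n) (hc.tensorPow hN.1 hσ.1 n) ε.2.2 herr
  have h2 := Real.logb_le_logb_of_le one_lt_two (mul_pos (pow_pos hd0 2) hε) h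
  rw [Real.logb_mul (pow_pos hd0 2).ne' hε.ne',
    Real.logb_mul (pow_pos hk n).ne' (pow_pos hl n).ne',
    Real.logb_pow, Real.logb_pow, Real.logb_pow, ← mul_add] at h2
  have h3 := mul_le_mul_of_nonneg_left hlog.le (Nat.cast_nonneg (α := ℝ) n)
  push_cast at h2
  exact EReal.coe_le_coe_iff.2 (by linarith)

/-- Encoders and an effect for all tensor powers of a channel. -/
lemma exists_encoders_tensorPow (hN : IsChannel N) {x : ℝ} (hx : x < IOmega N) (n : ℕ) :
    ∃ (s : (Fin n → B) × (Fin n → B) → ℂ) (E E' : LMap (Fin n → B) (Fin n → A)),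
      IsChannel E ∧ IsChannel E' ∧ ((2 : ℝ) ^ x) ^ n * (overlap s (tensorPow n N ∘ₗ E')).re ≤
        (overlap s (tensorPow n N ∘ₗ E)).re ∧ 0 < (overlap s (tensorPow n N ∘ₗ E)).re := by
  have h2 : (0 : ℝ) < 2 ^ x := Real.rpow_pos_of_pos two_pos x
  obtain ⟨s, E, E', hE, hE', hlt⟩ := exists_encoders hN (k := 2 ^ x) fun P hP => by
    have := IOmega_le_of_sandwich hN hP.1 hP.2
    rw [Real.logb_rpow two_pos (by norm_num)] at this
    exact hx.not_ge this
  have hre : ∀ F : LMap B A, IsChannel F →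
      (overlap (fun p : (Fin n → B) × (Fin n → B) => ∏ i, s (p.1 i, p.2 i))
        (tensorPow n N ∘ₗ tensorPow n F)).re = (overlap s (N ∘ₗ F)).re ^ n := by
    intro F hF
    rw [← tensorPow_comp, overlap_tensorPow, overlap_eq_ofReal s (hN.1.comp hF.1),
      ← Complex.ofReal_pow, Complex.ofReal_re, Complex.ofReal_re]
  have hq : 0 ≤ (overlap s (N ∘ₗ E')).re :=
    (Complex.le_def.1 (overlap_nonneg s (hN.1.comp hE'.1))).1
  have hp : 0 < (overlap s (N ∘ₗ E)).re := (mul_nonneg h2.le hq).trans_lt hlt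
  refine ⟨fun p => ∏ i, s (p.1 i, p.2 i), tensorPow n E, tensorPow n E',
    isChannel_tensorPow n hE, isChannel_tensorPow n hE', ?_, ?_⟩
  · rw [hre E hE, hre E' hE', ← mul_pow]
    exact pow_le_pow_left₀ (mul_nonneg h2.le hq) hlt.le n
  · rw [hre E hE]
    exact pow_pos hp n

lemma IsChannel.nonempty (hN : IsChannel N) : Nonempty B := by
  obtain ⟨a⟩ := ‹Nonempty A›
  by_contra h
  rw [not_nonempty_iff] at h
  have := hN.2 (Matrix.single a a 1)
  simp [Matrix.trace] at this

lemma le_capC_pEA (hN : IsChannel N) {x : ℝ} (hx : x < IOmega N) : x ≤ capC pEA N := by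
  have hB := hN.nonempty
  refine le_iInf fun ε => le_liminf_of_affine_le (Real.logb 2 (ε / (1 - ε))) fun n => ?_
  obtain ⟨hε0, hε1⟩ := ε.2
  have hε : 0 < 1 - (ε : ℝ) := by linarith
  have h2 : (0 : ℝ) < 2 ^ x := Real.rpow_pos_of_pos two_pos x
  obtain ⟨s, E, E', hE, hE', hκ, hpos⟩ := exists_encoders_tensorPow hN hx n
  set y : ℝ := (ε / (1 - ε)) * (2 ^ x) ^ n with hy
  have hy0 : 0 < y := by positivity
  -- The integer `⌊1 + y⌋₊` is the largest dimension `d` with `d - 1 ≤ y`, the condition for error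
  -- `ε`; it still exceeds `y`.
  have hd : 1 ≤ ⌊1 + y⌋₊ := Nat.le_floor (by push_cast; linarith)
  have hdy : (⌊1 + y⌋₊ : ℝ) ≤ 1 + y := Nat.floor_le (by linarith)
  have hdy' : y < ⌊1 + y⌋₊ := by linarith [Nat.lt_floor_add_one (1 + y)]
  obtain ⟨Θ, hΘ, herr⟩ := exists_isPEA_errC_le (isChannel_tensorPow n hN) hE hE' hκ hpos hd hε0 (by
    calc ((⌊1 + y⌋₊ : ℝ) - 1) * (1 - ε) ≤ y * (1 - ε) := by gcongr; linarith
      _ = ε * (2 ^ x) ^ n := by rw [hy]; field_simp)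
  refine le_trans ?_ (le_sSup ⟨_, Θ, hd, hΘ, herr, rfl⟩)
  refine EReal.coe_le_coe_iff.2 ?_
  calc n * x + Real.logb 2 (ε / (1 - ε)) = Real.logb 2 y := by
        rw [hy, Real.logb_mul (div_pos hε0 hε).ne' (pow_pos h2 n).ne', Real.logb_pow,
          Real.logb_rpow two_pos (by norm_num)]
        ring
    _ ≤ _ := Real.logb_le_logb_of_le one_lt_two hy0 hdy'.le

lemma le_capQ_pEA (hN : IsChannel N) {x : ℝ} (hx : x < IOmega N) :
    ((x / 2 : ℝ) : EReal) ≤ capQ pEA N := by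
  have hB := hN.nonempty
  refine le_iInf fun ε => le_liminf_of_affine_le ((Real.logb 2 (ε / (1 - ε)) - 2) / 2) fun n => ?_
  obtain ⟨hε0, hε1⟩ := ε.2
  have hε : 0 < 1 - (ε : ℝ) := by linarith
  have h2 : (0 : ℝ) < 2 ^ x := Real.rpow_pos_of_pos two_pos x
  obtain ⟨s, E, E', hE, hE', hκ, hpos⟩ := exists_encoders_tensorPow hN hx n
  set y : ℝ := (ε / (1 - ε)) * (2 ^ x) ^ n with hy
  have hy0 : 0 < y := by positivity
  set d := ⌊√(1 + y)⌋₊ with hd_def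
  have hsq : √(1 + y) ^ 2 = 1 + y := Real.sq_sqrt (by linarith)
  have hd : 1 ≤ d := Nat.le_floor (by
    rw [Nat.cast_one, Real.one_le_sqrt]
    linarith)
  have hd1 : (1 : ℝ) ≤ d := by exact_mod_cast hd
  have hdy : (d : ℝ) ≤ √(1 + y) := Nat.floor_le (Real.sqrt_nonneg _)
  have hdy' : √(1 + y) < d + 1 := Nat.lt_floor_add_one _
  have hd2 : (d : ℝ) ^ 2 ≤ 1 + y := by
    rw [← hsq]
    gcongr
  -- Since `d ≥ 1`, rounding down loses at most a factor `2` in `d`; this is the `-2` in the affine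
  -- constant.
  have hd4 : y ≤ 2 ^ 2 * (d : ℝ) ^ 2 := by
    nlinarith [Real.sqrt_nonneg (1 + y)]
  obtain ⟨Θ, hΘ, herr⟩ := exists_isPEA_errQ_le (isChannel_tensorPow n hN) hE hE' hκ hpos hd hε0 (by
    calc ((d : ℝ) ^ 2 - 1) * (1 - ε) ≤ y * (1 - ε) := by gcongr; linarith
      _ = ε * (2 ^ x) ^ n := by rw [hy]; field_simp)
  refine le_trans ?_ (le_sSup ⟨_, Θ, hd, hΘ, herr, rfl⟩)
  refine EReal.coe_le_coe_iff.2 ?_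
  have h3 : n * x + Real.logb 2 (ε / (1 - ε)) = Real.logb 2 y := by
    rw [hy, Real.logb_mul (div_pos hε0 hε).ne' (pow_pos h2 n).ne', Real.logb_pow,
      Real.logb_rpow two_pos (by norm_num)]
    ring
  have h4 := Real.logb_le_logb_of_le one_lt_two hy0 hd4
  rw [Real.logb_mul (x := 2 ^ 2) (y := (d : ℝ) ^ 2) (by norm_num) (by positivity),
    Real.logb_pow, Real.logb_pow, Real.logb_self_eq_one one_lt_two] at h4
  push_cast at h4
  linarith

end Capacities

end Postselected

end

theorem theorem3 {A : Type*} {B : Type*} [Fintype A] [DecidableEq A] [Nonempty A]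
    [Fintype B] [DecidableEq B] (N : LMap A B) (hN : IsChannel N) :
    capC pEA N = IOmega N ∧ capC pNA N = IOmega N ∧
    2 * capQ pEA N = IOmega N ∧ 2 * capQ pNA N = IOmega N ∧
    strongC pEA N = IOmega N ∧ strongC pNA N = IOmega N ∧
    2 * strongQ pEA N = IOmega N ∧ 2 * strongQ pNA N = IOmega N := by
  have mul2 : ∀ {a b : EReal}, a ≤ b → 2 * a ≤ 2 * b := fun h =>
    mul_le_mul_of_nonneg_left h (by norm_num)
  have half : ∀ x : ℝ, (2 : EReal) * ((x / 2 : ℝ) : EReal) = x := fun x => by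
    rw [show (2 : EReal) = ((2 : ℝ) : EReal) from rfl, ← EReal.coe_mul,
      mul_div_cancel₀ x two_ne_zero]
  -- Comparing through real thresholds `x` also covers an infinite `IOmega N`, without a case
  -- distinction.
  have c1 : IOmega N ≤ capC pEA N := EReal.ge_of_forall_gt_iff_ge.1 fun x hx => le_capC_pEA hN hx
  have c2 : strongC pNA N ≤ IOmega N :=
    EReal.le_of_forall_lt_iff_le.1 fun x hx => strongC_pNA_le hN hx
  have q1 : IOmega N ≤ 2 * capQ pEA N := EReal.ge_of_forall_gt_iff_ge.1 fun x hx => by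
    rw [← half x]
    exact mul2 (le_capQ_pEA hN hx)
  have q2 : 2 * strongQ pNA N ≤ IOmega N := EReal.le_of_forall_lt_iff_le.1 fun x hx => by
    rw [← half x]
    exact mul2 (strongQ_pNA_le hN hx)
  have c3 := capC_pEA_le N
  have c4 := capC_le_strongC N pNA
  have c5 := capC_le_strongC N pEA
  have c6 := strongC_pEA_le N
  have q3 := mul2 (capQ_pEA_le N)
  have q4 := mul2 (capQ_le_strongQ N pNA)
  have q5 := mul2 (capQ_le_strongQ N pEA)
  have q6 := mul2 (strongQ_pEA_le N)
  refine ⟨?_, ?_, ?_, ?_, ?_, ?_, ?_, ?_⟩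
  · exact le_antisymm (c3.trans (c4.trans c2)) c1
  · exact le_antisymm (c4.trans c2) (c1.trans c3)
  · exact le_antisymm (q3.trans (q4.trans q2)) q1
  · exact le_antisymm (q4.trans q2) (q1.trans q3)
  · exact le_antisymm (c6.trans c2) (c1.trans c5)
  · exact le_antisymm c2 (c1.trans (c5.trans c6))
  · exact le_antisymm (q6.trans q2) (q1.trans q5)
  · exact le_antisymm q2 (q1.trans (q5.trans q6))
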